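/- Let $n\ge 1$, let $\mathbb T^n$ carry normalized Lebesgue measure, and let $H^2(\mathbb D^n)$ be the Hardy space on the unit polydisc, identified via radial limits with the closed subspace of $L^2(\mathbb T^n)$ of functions whose Fourier coefficients vanish outside $\mathbb N^n$ (where $0\in\mathbb N$). For $\phi\in L^\infty(\mathbb T^n)$ let $T_\phi f=P_{H^2(\mathbb D^n)}(\phi f)$, $f\in H^2(\mathbb D^n)$, be the Toeplitz operator with symbol $\phi$. An inner function on $\mathbb D^n$ is a bounded holomorphic function $\theta$ on $\mathbb D^n$ whose radial boundary values satisfy $|\theta|=1$ a.e. on $\mathbb T^n$; $M_\theta$ denotes the Toeplitz operator on $H^2(\mathbb D^n)$ with symbol the boundary function of $\theta$, that is, multiplication by $\theta$. A bounded operator on a Hilbert space is a partial isometry if it is isometric on the orthogonal complement of its kernel. **Theorem.** Let $\phi\in L^\infty(\mathbb T^n)$ be non-zero (as an element of $L^\infty$). Then $T_\phi$ is a partial isometry if and only if there exist inner functions $\zeta,\psi$ on $\mathbb D^n$ depending on disjoint sets of variables (that is, there are disjoint $A,B\subseteq\{1,\dots,n\}$ such that $\zeta(z)$ depends only on the $z_i$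 with $i\in A$ and $\psi(z)$ only on the $z_i$ with $i\in B$) such that $$T_\phi=M_\psi^*M_\zeta .$$ -/

import Mathlib

open MeasureTheory Filter Topology
open scoped ENNReal

noncomputable section

namespace Polydisc

/-- Normalized Haar (Lebesgue) measure on the `n`-torus. The torus is parametrized by
`t ↦ (exp (2πi t₁), …, exp (2πi tₙ))`, `t ∈ (ℝ/ℤ)ⁿ`. -/
abbrev torusMeasure (n : ℕ) : Measure (UnitAddTorus (Fin n)) :=
  Measure.pi fun _ => AddCircle.haarAddCircle

/-- `L²(𝕋ⁿ)`. -/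
abbrev L2 (n : ℕ) := Lp ℂ 2 (torusMeasure n)

/-- `L^∞(𝕋ⁿ)`. -/
abbrev LInfty (n : ℕ) := Lp ℂ ∞ (torusMeasure n)

/-- The exponential monomial with exponent `k ∈ ℤⁿ`, as an element of `L²(𝕋ⁿ)`. -/
def monomial {n : ℕ} (k : Fin n → ℤ) : L2 n :=
  UnitAddTorus.mFourierLp 2 k

/-- The Hardy space, as a subspace of `L²(𝕋ⁿ)`: those functions all of whose Fourier coefficients
`⟨e_k, f⟩` with `k ∈ ℤⁿ \ ℕⁿ` vanish. The element with Fourier coefficients `(a_k)`, `k ∈ ℕⁿ`, is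
identified with the holomorphic function `∑ a_k z^k` on the polydisc. -/
def hardy (n : ℕ) : Submodule ℂ (L2 n) where
  carrier := {f | ∀ k : Fin n → ℤ, (∃ i, k i < 0) → inner ℂ (monomial k) f = 0}
  add_mem' := by
    intro f g hf hg k hk
    rw [inner_add_right, hf k hk, hg k hk, add_zero]
  zero_mem' := fun k _ => inner_zero_right _
  smul_mem' := by
    intro c f hf k hk
    rw [inner_smul_right, hf k hk, mul_zero]

lemma isClosed_hardy (n : ℕ) : IsClosed (hardy n : Set (L2 n)) := by
  have h : (hardy n : Set (L2 n)) =
      ⋂ (k : Fin n → ℤ) (_ : ∃ i, k i < 0), {f | inner ℂ (monomial k) f = 0} := by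
    ext f
    simp [hardy]
  rw [h]
  exact isClosed_iInter fun k => isClosed_iInter fun _ =>
    isClosed_eq (continuous_const.inner continuous_id) continuous_const

instance completeSpace_hardy (n : ℕ) : CompleteSpace (hardy n) :=
  (isClosed_hardy n).completeSpace_coe

/-- The Laurent operator: multiplication by `φ ∈ L^∞(𝕋ⁿ)` on `L²(𝕋ⁿ)`. -/
def laurent {n : ℕ} (φ : LInfty n) : L2 n →L[ℂ] L2 n :=
  (ContinuousLinearMap.mul ℂ ℂ).holderL (torusMeasure n) ∞ 2 2 φ

lemma coeFn_laurent {n : ℕ} (φ : LInfty n) (f : L2 n) :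
    laurent φ f =ᵐ[torusMeasure n] fun t => φ t * f t :=
  (ContinuousLinearMap.mul ℂ ℂ).coeFn_holder φ f

/-- The Toeplitz operator with symbol `φ ∈ L^∞(𝕋ⁿ)`: the compression of the Laurent operator of `φ`
to the Hardy space. -/
def toeplitz {n : ℕ} (φ : LInfty n) : hardy n →L[ℂ] hardy n :=
  (hardy n).orthogonalProjectionOnto ∘L laurent φ ∘L (hardy n).subtypeL

/-- A bounded operator on a Hilbert space is a partial isometry if it is isometric on the
orthogonal complement of its kernel. -/
def IsPartialIsometry {H : Type*} [NormedAddCommGroup H] [InnerProductSpace ℂ H]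
    (T : H →L[ℂ] H) : Prop :=
  ∀ x ∈ T.kerᗮ, ‖T x‖ = ‖x‖

/-- The open unit polydisc `𝔻ⁿ`. -/
def polydisc (n : ℕ) : Set (Fin n → ℂ) := {z | ∀ i, ‖z i‖ < 1}

/-- The point `r ζ` where `ζ ∈ 𝕋ⁿ` is the point with parameter `t`. -/
def radialPoint {n : ℕ} (r : ℝ) (t : UnitAddTorus (Fin n)) : Fin n → ℂ :=
  fun i => (r : ℂ) * (AddCircle.toCircle (t i) : ℂ)

/-- An inner function on the polydisc: a bounded holomorphic function whose radial boundary values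
are unimodular almost everywhere on the torus. (Values outside the polydisc are irrelevant.) -/
structure InnerFunction (n : ℕ) where
  toFun : (Fin n → ℂ) → ℂ
  holomorphic : DifferentiableOn ℂ toFun (polydisc n)
  bounded : ∃ C : ℝ, ∀ z ∈ polydisc n, ‖toFun z‖ ≤ C
  unimodular : ∀ᵐ t ∂torusMeasure n, ∃ w : ℂ, ‖w‖ = 1 ∧
    Tendsto (fun r : ℝ => toFun (radialPoint r t)) (𝓝[<] 1) (𝓝 w)

namespace InnerFunction

variable {n : ℕ}

/-- The radial boundary value of an inner function (meaningful at almost every point). -/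
def radialLimit (ψ : InnerFunction n) (t : UnitAddTorus (Fin n)) : ℂ :=
  limUnder (𝓝[<] (1 : ℝ)) fun r => ψ.toFun (radialPoint r t)

lemma ae_tendsto_radialLimit (ψ : InnerFunction n) :
    ∀ᵐ t ∂torusMeasure n,
      Tendsto (fun r : ℝ => ψ.toFun (radialPoint r t)) (𝓝[<] 1) (𝓝 (ψ.radialLimit t)) ∧
        ‖ψ.radialLimit t‖ = 1 := by
  filter_upwards [ψ.unimodular] with t ht
  obtain ⟨w, hw, hlim⟩ := ht
  have h : ψ.radialLimit t = w := hlim.limUnder_eq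
  rw [h]
  exact ⟨hlim, hw⟩

lemma radialPoint_mem {r : ℝ} (h0 : 0 ≤ r) (h1 : r < 1) (t : UnitAddTorus (Fin n)) :
    radialPoint r t ∈ polydisc n := by
  intro i
  have h : ‖(r : ℂ) * (AddCircle.toCircle (t i) : ℂ)‖ = r := by
    rw [norm_mul, Circle.norm_coe, mul_one, Complex.norm_real, Real.norm_of_nonneg h0]
  exact h.trans_lt h1

lemma continuous_radialPoint (r : ℝ) :
    Continuous (radialPoint r : UnitAddTorus (Fin n) → Fin n → ℂ) := by
  refine continuous_pi fun i => continuous_const.mul ?_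
  exact continuous_subtype_val.comp (AddCircle.continuous_toCircle.comp (continuous_apply i))

lemma aestronglyMeasurable_radialLimit (ψ : InnerFunction n) :
    AEStronglyMeasurable ψ.radialLimit (torusMeasure n) := by
  have hlt : ∀ m : ℕ, (1 : ℝ) - 1 / ((m : ℝ) + 1) < 1 := fun m => by
    have : (0 : ℝ) < 1 / ((m : ℝ) + 1) := by positivity
    linarith
  have hnn : ∀ m : ℕ, (0 : ℝ) ≤ 1 - 1 / ((m : ℝ) + 1) := fun m => by
    have : 1 / ((m : ℝ) + 1) ≤ 1 := by
      rw [div_le_one (by positivity)]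
      linarith [(Nat.cast_nonneg m : (0 : ℝ) ≤ m)]
    linarith
  have hr : Tendsto (fun m : ℕ => (1 : ℝ) - 1 / ((m : ℝ) + 1)) atTop (𝓝[<] 1) := by
    refine tendsto_nhdsWithin_iff.2 ⟨?_, Eventually.of_forall hlt⟩
    simpa using tendsto_const_nhds.sub (tendsto_one_div_add_atTop_nhds_zero_nat (𝕜 := ℝ))
  refine aestronglyMeasurable_of_tendsto_ae atTop
    (f := fun (m : ℕ) t => ψ.toFun (radialPoint (1 - 1 / ((m : ℝ) + 1)) t)) (fun m => ?_) ?_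
  · exact (ψ.holomorphic.continuousOn.comp_continuous (continuous_radialPoint _)
      fun t => radialPoint_mem (hnn m) (hlt m) t).aestronglyMeasurable
  · filter_upwards [ψ.ae_tendsto_radialLimit] with t ht
    exact ht.1.comp hr

lemma memLp_radialLimit (ψ : InnerFunction n) : MemLp ψ.radialLimit ∞ (torusMeasure n) :=
  memLp_top_of_bound ψ.aestronglyMeasurable_radialLimit 1
    (ψ.ae_tendsto_radialLimit.mono fun _ h => h.2.le)

/-- The boundary function of an inner function, as an element of `L^∞(𝕋ⁿ)`. -/
def boundary (ψ : InnerFunction n) : LInfty n := ψ.memLp_radialLimit.toLp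

/-- The analytic Toeplitz operator `M_ψ`, i.e. the Toeplitz operator whose symbol is the boundary
function of `ψ` (multiplication by `ψ` on the Hardy space). -/
def M (ψ : InnerFunction n) : hardy n →L[ℂ] hardy n := toeplitz ψ.boundary

/-- `ψ` depends, on the polydisc, only on the variables `z_i` with `i ∈ A`. -/
def DependsOnlyOn (ψ : InnerFunction n) (A : Set (Fin n)) : Prop :=
  ∀ z ∈ polydisc n, ∀ w ∈ polydisc n, (∀ i ∈ A, z i = w i) → ψ.toFun z = ψ.toFun w

end InnerFunction

end Polydisc

end

/-! Write H² for the Hardy space. Necessity: monomials of large degree carry trigonometric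
polynomials into H², so a bound for `T_φ` also bounds multiplication by φ on L² (`norm_laurent_le`),
and a partial isometry forces |φ| ≤ 1. On (ker T_φ)ᗮ no norm may be lost, either in multiplying by φ
or in projecting. Nonzero functions of H² are nonzero almost everywhere (`ae_ne_zero_of_mem_hardy`),
so |φ| = 1, and (ker T_φ)ᗮ lies in M = {f ∈ H² : φf ∈ H²}, which is closed and invariant under every
z_j.

The crux is `IsWandering.exists_add`: a vector of M ⊖ z_j M is a + c with a and φc both independent
of z_j. The other coordinate shifts preserve this description, so the shifts on M commute doubly and
a Beurling argument applies. If w is wandering for all j, then w̄f ∈ H² for f ∈ M; with f = w this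
makes |w| constant. Normalizing w gives ψ, and ζ = φψ lies in H² with φ = ψ̄ζ. The same splitting,
applied to ψ, shows that for each j one of ψ, ζ is independent of z_j (`exists_factorization`).

Sufficiency: `M_ψ` and `M_ζ` are isometries, and separation of variables gives M_ψ* M_ζ = M_ζ M_ψ*,
a coisometry followed by an isometry whose kernel is that of the coisometry.

It remains to match inner functions with unimodular elements of H². Radial limits of an inner
function have the right Fourier coefficients by the mean value property. Conversely the Szegő kernel
extends a unimodular element of H² to a holomorphic function bounded by 1, and Fatou's theorem,
obtained by slicing from the disc, recovers the boundary values. -/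

noncomputable section

namespace Polydisc

open UnitAddTorus ComplexConjugate

variable {n : ℕ}

/-! ### Fourier coefficients and multiplication operators -/

/-- The Fourier coefficient of `f ∈ L²(𝕋ⁿ)` at `k ∈ ℤⁿ`. -/
def coef (f : L2 n) (k : Fin n → ℤ) : ℂ := inner ℂ (monomial k) f

/-- The monomials as a Hilbert basis of `L²(𝕋ⁿ)`. -/
def basis (n : ℕ) : HilbertBasis (Fin n → ℤ) ℂ (L2 n) := mFourierBasis

lemma basis_apply (k : Fin n → ℤ) : basis n k = monomial k :=
  congrFun (coe_mFourierBasis (d := Fin n)) k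

lemma hasSum_coef (f g : L2 n) :
    HasSum (fun k => conj (coef f k) * coef g k) (inner ℂ f g) := by
  refine ((basis n).hasSum_inner_mul_inner f g).congr_fun fun k => ?_
  simp [basis_apply, coef, inner_conj_symm]

lemma ext_coef {f g : L2 n} (h : ∀ k, coef f k = coef g k) : f = g := by
  refine (basis n).repr.injective (lp.ext (funext fun k => ?_))
  rw [(basis n).repr_apply_apply, (basis n).repr_apply_apply, basis_apply]
  exact h k

lemma coeFn_monomial (k : Fin n → ℤ) : monomial k =ᵐ[torusMeasure n] mFourier k :=
  coeFn_mFourierLp 2 k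

lemma coef_monomial (k m : Fin n → ℤ) : coef (monomial k) m = if m = k then 1 else 0 :=
  orthonormal_iff_ite.1 (orthonormal_mFourier (d := Fin n)) m k

@[simp] lemma coef_add (f g : L2 n) (k : Fin n → ℤ) : coef (f + g) k = coef f k + coef g k :=
  inner_add_right _ _ _

@[simp] lemma coef_sub (f g : L2 n) (k : Fin n → ℤ) : coef (f - g) k = coef f k - coef g k :=
  inner_sub_right _ _ _

@[simp] lemma coef_smul (c : ℂ) (f : L2 n) (k : Fin n → ℤ) : coef (c • f) k = c * coef f k :=
  inner_smul_right _ _ _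

@[simp] lemma coef_zero (k : Fin n → ℤ) : coef (0 : L2 n) k = 0 := inner_zero_right _

lemma continuous_coef (k : Fin n → ℤ) : Continuous fun f : L2 n => coef f k :=
  continuous_const.inner continuous_id

lemma inner_eq_integral (f g : L2 n) :
    inner ℂ f g = ∫ t, conj (f t) * g t ∂torusMeasure n := by
  rw [L2.inner_def]
  simp only [RCLike.inner_apply, mul_comm]

lemma coef_eq_integral (f : L2 n) (k : Fin n → ℤ) :
    coef f k = ∫ t, mFourier (-k) t * f t ∂torusMeasure n := by
  rw [coef, inner_eq_integral]
  refine integral_congr_ae ?_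
  filter_upwards [coeFn_monomial k] with t ht
  rw [ht, mFourier_neg]

/-- The exponential monomial as an element of `L^∞(𝕋ⁿ)`. -/
def expSymbol (k : Fin n → ℤ) : LInfty n := mFourierLp ∞ k

lemma coeFn_expSymbol (k : Fin n → ℤ) : expSymbol k =ᵐ[torusMeasure n] mFourier k :=
  coeFn_mFourierLp ∞ k

/-- Multiplication by the exponential monomial with exponent `k`. -/
def shift (k : Fin n → ℤ) : L2 n →L[ℂ] L2 n := laurent (expSymbol k)

lemma coeFn_shift (k : Fin n → ℤ) (f : L2 n) :
    shift k f =ᵐ[torusMeasure n] fun t => mFourier k t * f t := by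
  filter_upwards [coeFn_laurent (expSymbol k) f, coeFn_expSymbol k] with t h1 h2
  rw [shift, h1, h2]

lemma laurent_comm (φ χ : LInfty n) (f : L2 n) :
    laurent φ (laurent χ f) = laurent χ (laurent φ f) := by
  refine Lp.ext ?_
  filter_upwards [coeFn_laurent φ (laurent χ f), coeFn_laurent χ f, coeFn_laurent χ (laurent φ f),
    coeFn_laurent φ f] with t h1 h2 h3 h4
  rw [h1, h2, h3, h4, mul_left_comm]

lemma laurent_shift (φ : LInfty n) (k : Fin n → ℤ) (f : L2 n) :
    laurent φ (shift k f) = shift k (laurent φ f) := laurent_comm _ _ _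

lemma inner_laurent (φ : LInfty n) (f g : L2 n) :
    inner ℂ (laurent φ f) g = inner ℂ f (laurent (star φ) g) := by
  rw [inner_eq_integral, inner_eq_integral]
  refine integral_congr_ae ?_
  filter_upwards [coeFn_laurent φ f, coeFn_laurent (star φ) g, Lp.coeFn_star φ] with t h1 h2 h3
  rw [h1, h2, h3, map_mul, Pi.star_apply, RCLike.star_def]
  ring

/-- A symbol of modulus one almost everywhere. -/
def Unimodular (φ : LInfty n) : Prop := ∀ᵐ t ∂torusMeasure n, ‖φ t‖ = 1

lemma unimodular_expSymbol (k : Fin n → ℤ) : Unimodular (expSymbol k) := by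
  filter_upwards [coeFn_expSymbol k] with t h
  rw [h]
  simp [mFourier, fourier_apply, Circle.norm_coe]

lemma laurent_star_laurent {φ : LInfty n} (h : Unimodular φ) (f : L2 n) :
    laurent (star φ) (laurent φ f) = f := by
  refine Lp.ext ?_
  filter_upwards [coeFn_laurent (star φ) (laurent φ f), coeFn_laurent φ f, Lp.coeFn_star φ, h]
    with t h1 h2 h3 h4
  rw [h1, h2, h3, ← mul_assoc, Pi.star_apply, RCLike.star_def, RCLike.conj_mul, h4]
  simp

lemma laurent_laurent_star {φ : LInfty n} (h : Unimodular φ) (f : L2 n) :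
    laurent φ (laurent (star φ) f) = f := by
  rw [laurent_comm, laurent_star_laurent h]

lemma inner_laurent_laurent {φ : LInfty n} (h : Unimodular φ) (f g : L2 n) :
    inner ℂ (laurent φ f) (laurent φ g) = inner ℂ f g := by
  rw [inner_laurent, laurent_star_laurent h]

lemma norm_laurent {φ : LInfty n} (h : Unimodular φ) (f : L2 n) : ‖laurent φ f‖ = ‖f‖ := by
  rw [norm_eq_sqrt_re_inner (𝕜 := ℂ),
    inner_laurent_laurent h, ← norm_eq_sqrt_re_inner]

lemma shift_shift (k m : Fin n → ℤ) (f : L2 n) : shift k (shift m f) = shift (k + m) f := by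
  refine Lp.ext ?_
  filter_upwards [coeFn_shift k (shift m f), coeFn_shift m f, coeFn_shift (k + m) f]
    with t h1 h2 h3
  rw [h1, h2, h3, mFourier_add, mul_assoc]

@[simp] lemma shift_zero (f : L2 n) : shift 0 f = f := by
  refine Lp.ext ?_
  filter_upwards [coeFn_shift 0 f] with t h1
  rw [h1, mFourier_zero, ContinuousMap.one_apply, one_mul]

lemma shift_monomial (k m : Fin n → ℤ) : shift k (monomial m) = monomial (k + m) := by
  refine Lp.ext ?_
  filter_upwards [coeFn_shift k (monomial m), coeFn_monomial m, coeFn_monomial (k + m)]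
    with t h1 h2 h3
  rw [h1, h2, h3, mFourier_add]

lemma inner_shift_shift (k : Fin n → ℤ) (f g : L2 n) :
    inner ℂ (shift k f) (shift k g) = inner ℂ f g :=
  inner_laurent_laurent (unimodular_expSymbol k) f g

lemma norm_shift (k : Fin n → ℤ) (f : L2 n) : ‖shift k f‖ = ‖f‖ :=
  norm_laurent (unimodular_expSymbol k) f

lemma inner_shift_left (k : Fin n → ℤ) (f g : L2 n) :
    inner ℂ (shift k f) g = inner ℂ f (shift (-k) g) := by
  rw [← inner_shift_shift k f, shift_shift, add_neg_cancel, shift_zero]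

lemma inner_shift_right (k : Fin n → ℤ) (f g : L2 n) :
    inner ℂ f (shift k g) = inner ℂ (shift (-k) f) g := by
  rw [inner_shift_left, neg_neg]

lemma coef_shift (k m : Fin n → ℤ) (f : L2 n) : coef (shift k f) m = coef f (m - k) := by
  rw [coef, inner_shift_right, shift_monomial, coef, neg_add_eq_sub]

/-- A bounded function, as an element of `L²`. -/
def toL2 (φ : LInfty n) : L2 n := laurent φ (monomial 0)

lemma coeFn_toL2 (φ : LInfty n) : toL2 φ =ᵐ[torusMeasure n] φ := by
  filter_upwards [coeFn_laurent φ (monomial 0), coeFn_monomial (0 : Fin n → ℤ)] with t h1 h2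
  rw [toL2, h1, h2, mFourier_zero, ContinuousMap.one_apply, mul_one]

lemma laurent_monomial (φ : LInfty n) (k : Fin n → ℤ) :
    laurent φ (monomial k) = shift k (toL2 φ) := by
  rw [toL2, ← laurent_shift, shift_monomial, add_zero]

lemma coef_star (φ : LInfty n) (k : Fin n → ℤ) :
    coef (toL2 (star φ)) k = conj (coef (toL2 φ) (-k)) := by
  rw [coef, coef, toL2, ← inner_laurent, laurent_monomial, inner_shift_left, inner_conj_symm,
    shift_monomial, add_zero, toL2]

/-- The coefficients of a product are given by the convolution of the coefficients. -/
lemma hasSum_coef_laurent (φ : LInfty n) (f : L2 n) (k : Fin n → ℤ) :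
    HasSum (fun m => coef (toL2 φ) (k - m) * coef f m) (coef (laurent φ f) k) := by
  have h := hasSum_coef (laurent (star φ) (monomial k)) f
  rw [inner_laurent, star_star] at h
  refine h.congr_fun fun m => ?_
  rw [laurent_monomial, coef_shift, coef_star, Complex.conj_conj, neg_sub]

/-- Reduces vanishing statements about products to comparing supports, since every term of the
convolution is zero. -/
lemma coef_laurent_eq_zero {φ : LInfty n} {f : L2 n} {k : Fin n → ℤ}
    (h : ∀ m, coef (toL2 φ) (k - m) = 0 ∨ coef f m = 0) : coef (laurent φ f) k = 0 := by
  refine (hasSum_coef_laurent φ f k).unique ?_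
  convert! hasSum_zero with m
  rcases h m with h | h <;> simp [h]

/-- The functions whose Fourier coefficients vanish outside `S`. -/
def spec (S : Set (Fin n → ℤ)) : Submodule ℂ (L2 n) where
  carrier := {f | ∀ k, k ∉ S → coef f k = 0}
  add_mem' := by
    intro f g hf hg k hk
    rw [coef_add, hf k hk, hg k hk, add_zero]
  zero_mem' := fun k _ => coef_zero k
  smul_mem' := by
    intro c f hf k hk
    rw [coef_smul, hf k hk, mul_zero]

lemma isClosed_spec (S : Set (Fin n → ℤ)) : IsClosed (spec S : Set (L2 n)) := by
  have h : (spec S : Set (L2 n)) = ⋂ (k : Fin n → ℤ) (_ : k ∉ S), {f | coef f k = 0} := by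
    ext f
    simp [spec]
  rw [h]
  exact isClosed_iInter fun k => isClosed_iInter fun _ =>
    isClosed_eq (continuous_coef k) continuous_const

lemma mem_hardy {f : L2 n} : f ∈ hardy n ↔ ∀ k, (∃ i, k i < 0) → coef f k = 0 := Iff.rfl

lemma monomial_mem_hardy {k : Fin n → ℤ} (hk : ∀ i, 0 ≤ k i) : monomial k ∈ hardy n := by
  rintro m ⟨i, hi⟩
  refine (coef_monomial k m).trans (if_neg ?_)
  rintro rfl
  exact absurd (hk i) (not_le.2 hi)

lemma shift_mem_hardy {k : Fin n → ℤ} (hk : ∀ i, 0 ≤ k i) {f : L2 n} (hf : f ∈ hardy n) :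
    shift k f ∈ hardy n := by
  rintro m ⟨i, hi⟩
  change coef _ _ = 0
  rw [coef_shift]
  refine hf _ ⟨i, ?_⟩
  have := hk i
  simp only [Pi.sub_apply]
  omega

/-- A function is orthogonal to the Hardy space iff its coefficients on `ℕⁿ` vanish. -/
lemma mem_hardy_orthogonal {f : L2 n} :
    f ∈ (hardy n)ᗮ ↔ ∀ k, (∀ i, 0 ≤ k i) → coef f k = 0 := by
  rw [Submodule.mem_orthogonal]
  refine ⟨fun h k hk => h _ (monomial_mem_hardy hk), fun h g hg => ?_⟩
  refine (hasSum_coef g f).unique ?_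
  convert! hasSum_zero with k
  by_cases hk : ∀ i, 0 ≤ k i
  · rw [h k hk, mul_zero]
  · push Not at hk
    rw [mem_hardy.1 hg k hk, map_zero, zero_mul]

lemma coef_proj (f : L2 n) {k : Fin n → ℤ} (hk : ∀ i, 0 ≤ k i) :
    coef ((hardy n).starProjection f) k = coef f k := by
  have h := mem_hardy_orthogonal.1 (Submodule.sub_starProjection_mem_orthogonal (K := hardy n) f)
    k hk
  rw [coef_sub, sub_eq_zero] at h
  exact h.symm

lemma toeplitz_apply (φ : LInfty n) (f : hardy n) :
    (toeplitz φ f : L2 n) = (hardy n).starProjection (laurent φ f) := rfl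

end Polydisc
end

noncomputable section

namespace Polydisc

open UnitAddTorus ComplexConjugate

variable {n : ℕ}

/-! ### Functions of constant modulus and zero sets -/

/-- An integrable function all of whose integrals against monomials vanish is zero. -/
lemma ae_eq_zero_of_integral_mFourier {g : UnitAddTorus (Fin n) → ℝ}
    (hg : Integrable g (torusMeasure n))
    (h : ∀ k : Fin n → ℤ, ∫ t, mFourier k t * (g t : ℂ) ∂torusMeasure n = 0) :
    g =ᵐ[torusMeasure n] 0 := by
  have hgC : Integrable (fun t => (g t : ℂ)) (torusMeasure n) := hg.ofReal
  have hint (u : C(UnitAddTorus (Fin n), ℂ)) :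
      Integrable (fun t => u t * (g t : ℂ)) (torusMeasure n) :=
    hgC.bdd_mul u.continuous.aestronglyMeasurable (c := ‖u‖)
      (Eventually.of_forall u.norm_coe_le_norm)
  let ℓ : C(UnitAddTorus (Fin n), ℂ) →ₗ[ℂ] ℂ :=
    { toFun := fun u => ∫ t, u t * (g t : ℂ) ∂torusMeasure n
      map_add' := fun u v => by
        simp only [ContinuousMap.add_apply, add_mul]
        exact integral_add (hint u) (hint v)
      map_smul' := fun c u => by
        simp only [ContinuousMap.smul_apply, smul_eq_mul, mul_assoc, RingHom.id_apply]
        exact integral_const_mul c _ }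
  have hℓ : Continuous ℓ := by
    refine (ℓ.mkContinuous (∫ t, ‖g t‖ ∂torusMeasure n) fun u => ?_).continuous
    calc ‖ℓ u‖ ≤ ∫ t, ‖u t * (g t : ℂ)‖ ∂torusMeasure n := norm_integral_le_integral_norm _
      _ ≤ ∫ t, ‖g t‖ * ‖u‖ ∂torusMeasure n := by
        refine integral_mono (hint u).norm (hg.norm.mul_const _) fun t => ?_
        simp only [norm_mul, Complex.norm_real]
        rw [mul_comm]
        exact mul_le_mul_of_nonneg_left (u.norm_coe_le_norm t) (norm_nonneg _)
      _ = _ := integral_mul_const _ _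
  have h0 (u : C(UnitAddTorus (Fin n), ℂ)) : ℓ u = 0 := by
    have hu : u ∈ (Submodule.span ℂ (Set.range <| mFourier (d := Fin n))).topologicalClosure := by
      rw [span_mFourier_closure_eq_top]
      trivial
    have hcl : IsClosed (LinearMap.ker ℓ : Set C(UnitAddTorus (Fin n), ℂ)) := by
      have : (LinearMap.ker ℓ : Set C(UnitAddTorus (Fin n), ℂ)) = ℓ ⁻¹' {0} := rfl
      rw [this]
      exact isClosed_singleton.preimage hℓ
    refine Submodule.topologicalClosure_minimal _ (t := LinearMap.ker ℓ) ?_ hcl hu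
    rw [Submodule.span_le]
    rintro _ ⟨k, rfl⟩
    exact h k
  have hpos (u : BoundedContinuousFunction (UnitAddTorus (Fin n)) ℝ) :
      ∫ t, u t * g t ∂torusMeasure n = 0 := by
    have := h0 ⟨fun t => (u t : ℂ), by fun_prop⟩
    change ∫ t, (u t : ℂ) * (g t : ℂ) ∂torusMeasure n = 0 at this
    simp only [← Complex.ofReal_mul] at this
    rw [integral_complex_ofReal] at this
    exact_mod_cast this
  have hneg : Integrable (fun t => -g t) (torusMeasure n) := hg.neg
  -- The positive and negative parts of `g` are densities of finite measures with equal integrals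
  -- against continuous functions. The measures agree, hence so do the two parts, and both must
  -- vanish.
  have hν : (torusMeasure n).withDensity (fun t => ENNReal.ofReal (g t)) =
      (torusMeasure n).withDensity (fun t => ENNReal.ofReal (-g t)) := by
    have := isFiniteMeasure_withDensity_ofReal hg.2
    have := isFiniteMeasure_withDensity_ofReal hneg.2
    refine ext_of_forall_integral_eq_of_IsFiniteMeasure fun u => ?_
    rw [integral_withDensity_eq_integral_toReal_smul₀ hg.aemeasurable.ennreal_ofReal
        (Eventually.of_forall fun _ => ENNReal.ofReal_lt_top),
      integral_withDensity_eq_integral_toReal_smul₀ hneg.aemeasurable.ennreal_ofReal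
        (Eventually.of_forall fun _ => ENNReal.ofReal_lt_top), ← sub_eq_zero]
    have hb {v : UnitAddTorus (Fin n) → ℝ} (hv : Integrable v (torusMeasure n)) :
        Integrable (fun t => (ENNReal.ofReal (v t)).toReal • u t) (torusMeasure n) := by
      have : Integrable (fun t => u t * max (v t) 0) (torusMeasure n) :=
        (hv.pos_part).bdd_mul u.continuous.aestronglyMeasurable (c := ‖u‖)
          (Eventually.of_forall u.norm_coe_le_norm)
      refine this.congr (Eventually.of_forall fun t => ?_)
      simp [ENNReal.toReal_ofReal', mul_comm]
    rw [← integral_sub (hb hg) (hb hneg), ← hpos u]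
    refine integral_congr_ae (Eventually.of_forall fun t => ?_)
    simp only [ENNReal.toReal_ofReal', smul_eq_mul]
    rcases le_total 0 (g t) with h | h
    · rw [max_eq_left h, max_eq_right (by linarith)]; ring
    · rw [max_eq_right h, max_eq_left (by linarith)]; ring
  have hae := (withDensity_eq_iff hg.aemeasurable.ennreal_ofReal
    hneg.aemeasurable.ennreal_ofReal hg.lintegral_lt_top.ne).1 hν
  filter_upwards [hae] with t ht
  rcases le_total 0 (g t) with h | h
  · rw [ENNReal.ofReal_eq_zero.2 (show -g t ≤ 0 by linarith), ENNReal.ofReal_eq_zero] at ht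
    exact le_antisymm ht h
  · rw [ENNReal.ofReal_eq_zero.2 h] at ht
    have := ENNReal.ofReal_eq_zero.1 ht.symm
    exact le_antisymm h (neg_nonpos.1 this)

lemma integrable_normSq (f : L2 n) : Integrable (fun t => ‖f t‖ ^ 2) (torusMeasure n) :=
  (memLp_two_iff_integrable_sq_norm (Lp.memLp f).1).1 (Lp.memLp f)

lemma integral_normSq (f : L2 n) : ∫ t, ‖f t‖ ^ 2 ∂torusMeasure n = ‖f‖ ^ 2 := by
  have h := inner_eq_integral f f
  have h2 : ∀ t, conj (f t) * f t = ((‖f t‖ ^ 2 : ℝ) : ℂ) := fun t => by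
    rw [RCLike.conj_mul]; norm_cast
  simp only [h2] at h
  rw [integral_complex_ofReal, inner_self_eq_norm_sq_to_K] at h
  exact Complex.ofReal_injective (h.symm.trans (by norm_cast))

/-- A function orthogonal to all its nontrivial translates in frequency has constant modulus. -/
lemma norm_eq_of_inner_shift {f : L2 n} (h : ∀ k ≠ 0, inner ℂ (shift k f) f = 0) :
    ∀ᵐ t ∂torusMeasure n, ‖f t‖ = ‖f‖ := by
  have hint : Integrable (fun t => ‖f t‖ ^ 2 - ‖f‖ ^ 2) (torusMeasure n) :=
    (integrable_normSq f).sub (integrable_const _)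
  have key := ae_eq_zero_of_integral_mFourier hint fun k => ?_
  · filter_upwards [key] with t ht
    have : ‖f t‖ ^ 2 = ‖f‖ ^ 2 := sub_eq_zero.1 ht
    exact (sq_eq_sq₀ (norm_nonneg _) (norm_nonneg _)).1 this
  -- The Fourier coefficients of |f|² are the correlations of `f` with its frequency translates.
  have h1 : ∫ t, mFourier k t * ((‖f t‖ ^ 2 : ℝ) : ℂ) ∂torusMeasure n
      = inner ℂ (shift (-k) f) f := by
    rw [inner_eq_integral]
    refine integral_congr_ae ?_
    filter_upwards [coeFn_shift (-k) f] with t ht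
    rw [ht, map_mul, mFourier_neg, Complex.conj_conj, mul_assoc, RCLike.conj_mul]
    norm_cast
  have h2 : ∫ t, mFourier k t ∂torusMeasure n = if k = 0 then 1 else 0 := by
    have := coef_eq_integral (monomial (0 : Fin n → ℤ)) (-k)
    rw [coef_monomial, neg_neg] at this
    simp only [neg_eq_zero] at this
    rw [this]
    refine integral_congr_ae ?_
    filter_upwards [coeFn_monomial (0 : Fin n → ℤ)] with t ht
    rw [ht, mFourier_zero, ContinuousMap.one_apply, mul_one]
  have hk1 : Integrable (fun t => mFourier k t * ((‖f t‖ ^ 2 : ℝ) : ℂ)) (torusMeasure n) :=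
    (integrable_normSq f).ofReal.bdd_mul (mFourier k).continuous.aestronglyMeasurable (c := 1)
      (Eventually.of_forall fun t => by
        simpa [mFourier_norm] using (mFourier k).norm_coe_le_norm t)
  have hk2 : Integrable (fun t => mFourier k t * ((‖f‖ ^ 2 : ℝ) : ℂ)) (torusMeasure n) :=
    (integrable_const (((‖f‖ ^ 2 : ℝ) : ℂ))).bdd_mul
      (mFourier k).continuous.aestronglyMeasurable (c := 1)
      (Eventually.of_forall fun t => by
        simpa [mFourier_norm] using (mFourier k).norm_coe_le_norm t)
  simp only [Complex.ofReal_sub, mul_sub]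
  rw [integral_sub hk1 hk2, h1, integral_mul_const, h2]
  by_cases hk : k = 0
  · subst hk
    simp [inner_self_eq_norm_sq_to_K]
  · rw [h _ (neg_ne_zero.2 hk), if_neg hk]
    simp

/-- Positivity of a frequency in the lexicographic order. -/
def LexPos (k : Fin n → ℤ) : Prop := ∃ i, (∀ j < i, k j = 0) ∧ 0 < k i

lemma LexPos.add {k m : Fin n → ℤ} (hk : LexPos k) (hm : LexPos m) : LexPos (k + m) := by
  obtain ⟨i, hi, hi'⟩ := hk
  obtain ⟨j, hj, hj'⟩ := hm
  rcases lt_trichotomy i j with h | rfl | h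
  · exact ⟨i, fun l hl => by simp [hi l hl, hj l (hl.trans h)], by simpa [hj i h] using hi'⟩
  · exact ⟨i, fun l hl => by simp [hi l hl, hj l hl], by simpa using add_pos hi' hj'⟩
  · exact ⟨j, fun l hl => by simp [hj l hl, hi l (hl.trans h)], by simpa [hi j h] using hj'⟩

lemma lexPos_or_neg {k : Fin n → ℤ} (hk : k ≠ 0) : LexPos k ∨ LexPos (-k) := by
  classical
  have hne : (Finset.univ.filter fun i => k i ≠ 0).Nonempty := by
    obtain ⟨i, hi⟩ := Function.ne_iff.1 hk
    exact ⟨i, by simpa using hi⟩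
  obtain ⟨i, hi, hmin⟩ := Finset.exists_min_image _ id hne
  have h0 : ∀ j < i, k j = 0 := fun j hj => by
    by_contra hne
    exact absurd (hmin j (by simpa using hne)) (not_le.2 hj)
  have hi' : k i ≠ 0 := by simpa using hi
  rcases lt_or_gt_of_ne hi' with h | h
  · exact Or.inr ⟨i, fun j hj => by simp [h0 j hj], by simpa using h⟩
  · exact Or.inl ⟨i, h0, h⟩

/-- A nonempty set of frequencies in `ℕⁿ` has a lexicographically minimal element. -/
lemma exists_lex_min {S : Set (Fin n → ℤ)} (hS : S.Nonempty) (hpos : ∀ k ∈ S, ∀ i, 0 ≤ k i) :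
    ∃ k ∈ S, ∀ m ∈ S, ¬ LexPos (k - m) := by
  -- The lexicographic order is well-founded on ℕⁿ but not on ℤⁿ, hence the transfer.
  let S' : Set (Lex (Fin n → ℕ)) := {a | (fun i => ((ofLex a i : ℕ) : ℤ)) ∈ S}
  have hS' : S'.Nonempty := by
    obtain ⟨k, hk⟩ := hS
    refine ⟨toLex fun i => (k i).toNat, ?_⟩
    change (fun i => (((k i).toNat : ℕ) : ℤ)) ∈ S
    convert! hk using 1
    funext i
    exact Int.toNat_of_nonneg (hpos k hk i)
  have wf : WellFounded ((· < ·) : Lex (Fin n → ℕ) → Lex (Fin n → ℕ) → Prop) := wellFounded_lt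
  refine ⟨_, wf.min_mem S' hS', fun m hm hlex => ?_⟩
  have hm' : toLex (fun i => (m i).toNat) ∈ S' := by
    change (fun i => (((m i).toNat : ℕ) : ℤ)) ∈ S
    convert! hm using 1
    funext i
    exact Int.toNat_of_nonneg (hpos m hm i)
  refine wf.not_lt_min S' hm' ?_
  obtain ⟨i, hi, hi'⟩ := hlex
  refine ⟨i, fun j hj => ?_, ?_⟩
  · have := hi j hj
    simp only [Pi.sub_apply, sub_eq_zero] at this
    change (m j).toNat = _
    rw [← this]
    exact Int.toNat_natCast _
  · have := hpos m hm i
    simp only [Pi.sub_apply] at hi'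
    change (m i).toNat < _
    zify
    rw [Int.toNat_of_nonneg this]
    exact sub_pos.1 hi'

/-- A nonzero function in the Hardy space is nonzero almost everywhere. -/
theorem ae_ne_zero_of_mem_hardy {f : L2 n} (hf : f ∈ hardy n) (hf0 : f ≠ 0) :
    ∀ᵐ t ∂torusMeasure n, f t ≠ 0 := by
  obtain ⟨k₀, hk₀, hmin⟩ : ∃ k ∈ {k | coef f k ≠ 0}, ∀ m ∈ {k | coef f k ≠ 0}, ¬ LexPos (k - m) := by
    refine exists_lex_min ?_ fun k hk i => ?_
    · by_contra h
      rw [Set.not_nonempty_iff_eq_empty, Set.eq_empty_iff_forall_notMem] at h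
      refine hf0 (ext_coef fun k => ?_)
      rw [coef_zero]
      simpa using h k
    · by_contra hi
      exact hk (mem_hardy.1 hf k ⟨i, not_le.1 hi⟩)
  -- Helson–Lowdenslager argument: lexicographically positive frequencies play the role of positive
  -- integers. The part `g` of `f` orthogonal to `V` will have constant nonzero modulus, yet it
  -- vanishes wherever `f` does.
  let V : Submodule ℂ (L2 n) :=
    (Submodule.span ℂ {g | ∃ k, LexPos k ∧ g = shift k f}).topologicalClosure
  have : CompleteSpace V := (Submodule.isClosed_topologicalClosure _).completeSpace_coe
  let p := V.starProjection f
  let g := f - p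
  have hpV : p ∈ V := Submodule.starProjection_apply_mem _ _
  have hVmem {k : Fin n → ℤ} (hk : LexPos k) : shift k f ∈ V :=
    Submodule.le_topologicalClosure _ (Submodule.subset_span ⟨k, hk, rfl⟩)
  -- a closed subspace containing the generators contains `V`
  have hmono {W : Submodule ℂ (L2 n)} (hW : IsClosed (W : Set (L2 n)))
      (h : ∀ k, LexPos k → shift k f ∈ W) : V ≤ W := by
    refine Submodule.topologicalClosure_minimal _ (Submodule.span_le.2 ?_) hW
    rintro _ ⟨k, hk, rfl⟩
    exact h k hk
  have hshiftV {k : Fin n → ℤ} (hk : LexPos k) {v : L2 n} (hv : v ∈ V) : shift k v ∈ V := by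
    refine hmono (W := V.comap (shift k : L2 n →ₗ[ℂ] L2 n)) ?_ (fun m hm => ?_) hv
    · exact (Submodule.isClosed_topologicalClosure _).preimage (shift k).continuous
    · change shift k (shift m f) ∈ V
      rw [shift_shift]
      exact hVmem (hk.add hm)
  -- By minimality of `k₀`, every generator of `V` has zero coefficient there, whereas `f` does not.
  have hg0 : g ≠ 0 := by
    intro h
    have hfV : f ∈ V := by
      rw [sub_eq_zero.1 h]
      exact hpV
    have hle : V ≤ spec {k | k ≠ k₀} := by
      refine hmono (isClosed_spec _) fun k hk m hm => ?_
      obtain rfl : m = k₀ := by simpa using hm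
      rw [coef_shift]
      by_contra hne
      exact hmin _ hne (by simpa using hk)
    exact hk₀ (hle hfV k₀ (by simp))
  have hpos {k : Fin n → ℤ} (hk : LexPos k) : inner ℂ (shift k g) g = 0 := by
    have h1 : shift k g ∈ V := by
      simp only [g, map_sub]
      exact V.sub_mem (hVmem hk) (hshiftV hk hpV)
    exact (Submodule.mem_orthogonal _ _).1 (Submodule.sub_starProjection_mem_orthogonal f) _ h1
  have hmod := norm_eq_of_inner_shift (f := g) fun k hk => by
    rcases lexPos_or_neg hk with h | h
    · exact hpos h
    · rw [inner_shift_left, ← inner_conj_symm, hpos h, map_zero]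
  -- members of `V` vanish where `f` does
  have hvan : ∀ᵐ t ∂torusMeasure n, f t = 0 → p t = 0 := by
    let χ : UnitAddTorus (Fin n) → ℂ := Set.indicator {t | f t ≠ 0}ᶜ 1
    have hms : MeasurableSet {t | f t ≠ 0}ᶜ :=
      ((Lp.stronglyMeasurable f).measurable (measurableSet_singleton 0).compl).compl
    have hχ : MemLp χ ∞ (torusMeasure n) :=
      memLp_top_of_bound ((stronglyMeasurable_one.indicator hms).aestronglyMeasurable) 1
        (Eventually.of_forall fun t => by
          by_cases h : t ∈ {t | f t ≠ 0}ᶜ <;> simp [χ, h])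
    have hle : V ≤ LinearMap.ker (laurent hχ.toLp : L2 n →ₗ[ℂ] L2 n) := by
      refine hmono ?_ fun k _ => ?_
      · exact isClosed_singleton.preimage (laurent hχ.toLp).continuous
      · change laurent hχ.toLp (shift k f) = 0
        refine Lp.ext ?_
        filter_upwards [coeFn_laurent hχ.toLp (shift k f), coeFn_shift k f, hχ.coeFn_toLp,
          Lp.coeFn_zero ℂ 2 (torusMeasure n)] with t h1 h2 h3 h4
        rw [h1, h2, h3, h4]
        by_cases h : f t = 0 <;> simp [χ, h]
    have h0 : laurent hχ.toLp p = 0 := hle hpV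
    have h0' : laurent hχ.toLp p =ᵐ[torusMeasure n] 0 := by
      rw [h0]
      exact Lp.coeFn_zero _ _ _
    filter_upwards [h0', coeFn_laurent hχ.toLp p, hχ.coeFn_toLp] with t h1 h2 h3 h4
    rw [h2, h3] at h1
    simpa [χ, h4] using h1
  filter_upwards [hmod, hvan, Lp.coeFn_sub f p] with t h1 h2 h3 h4
  rw [show g t = f t - p t from h3, h4, h2 h4, sub_zero, norm_zero] at h1
  exact hg0 (norm_eq_zero.1 h1.symm)

end Polydisc
end

noncomputable section

namespace Polydisc

open UnitAddTorus ComplexConjugate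

variable {n : ℕ}

/-! ### The initial space of a partially isometric Toeplitz operator -/

/-- The functions in the Hardy space which do not depend on the `j`-th variable. -/
def indep (j : Fin n) : Submodule ℂ (L2 n) := spec {k | (∀ i, 0 ≤ k i) ∧ k j = 0}

lemma indep_le_hardy (j : Fin n) : indep j ≤ hardy n := fun _ hf k ⟨i, hi⟩ =>
  hf k fun hk => absurd (hk.1 i) (not_le.2 hi)

lemma shift_mem_indep {j : Fin n} {k : Fin n → ℤ} (hk : ∀ i, 0 ≤ k i) (hkj : k j = 0) {f : L2 n}
    (hf : f ∈ indep j) : shift k f ∈ indep j := by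
  intro m hm
  rw [coef_shift]
  refine hf _ fun h => hm ⟨fun i => ?_, ?_⟩
  · have := h.1 i
    have := hk i
    simp only [Pi.sub_apply] at *
    omega
  · have := h.2
    simp only [Pi.sub_apply] at this
    omega

/-- The exponent of the `j`-th coordinate function. -/
abbrev unit (j : Fin n) : Fin n → ℤ := Pi.single j 1

lemma unit_nonneg (j : Fin n) (i : Fin n) : 0 ≤ unit j i := by
  by_cases h : i = j
  · subst h; simp
  · simp [h]

/-- Together with `mem_indep_of_inner` this identifies `indep j` with H² ⊖ z_j H², the form in which
independence of a variable meets wandering vectors. -/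
lemma inner_shift_indep {j : Fin n} {u g : L2 n} (hu : u ∈ indep j) (hg : g ∈ hardy n) :
    inner ℂ (shift (unit j) g) u = 0 := by
  refine (hasSum_coef _ u).unique ?_
  convert! hasSum_zero with k
  by_cases hk : k ∈ {k : Fin n → ℤ | (∀ i, 0 ≤ k i) ∧ k j = 0}
  · rw [coef_shift, mem_hardy.1 hg, map_zero, zero_mul]
    exact ⟨j, by simp [hk.2]⟩
  · rw [hu k hk, mul_zero]

lemma mem_indep_of_inner {j : Fin n} {u : L2 n} (hu : u ∈ hardy n)
    (h : ∀ g ∈ hardy n, inner ℂ (shift (unit j) g) u = 0) : u ∈ indep j := by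
  intro k hk
  by_cases hpos : ∀ i, 0 ≤ k i
  · have hkj : 0 < k j := lt_of_le_of_ne (hpos j) fun h0 => hk ⟨hpos, h0.symm⟩
    have := h (monomial (k - unit j)) (monomial_mem_hardy fun i => ?_)
    · rwa [shift_monomial, add_sub_cancel] at this
    · by_cases hij : i = j
      · subst hij
        simp only [Pi.sub_apply, Pi.single_eq_same]
        omega
      · simpa [hij] using hpos i
  · push Not at hpos
    exact mem_hardy.1 hu k hpos

/-- The functions in the Hardy space whose product with `φ` is in the Hardy space. -/
def initialSpace (φ : LInfty n) : Submodule ℂ (L2 n) :=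
  hardy n ⊓ (hardy n).comap (laurent φ : L2 n →ₗ[ℂ] L2 n)

lemma isClosed_initialSpace (φ : LInfty n) : IsClosed (initialSpace φ : Set (L2 n)) :=
  (isClosed_hardy n).inter ((isClosed_hardy n).preimage (laurent φ).continuous)

lemma shift_mem_initialSpace {φ : LInfty n} {k : Fin n → ℤ} (hk : ∀ i, 0 ≤ k i) {f : L2 n}
    (hf : f ∈ initialSpace φ) : shift k f ∈ initialSpace φ :=
  ⟨shift_mem_hardy hk hf.1, by
    change laurent φ (shift k f) ∈ hardy n
    rw [laurent_shift]
    exact shift_mem_hardy hk hf.2⟩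

/-- The orthogonal complement of `z_j M` in `M`, where `M` is the initial space of `φ`. -/
def IsWandering (φ : LInfty n) (j : Fin n) (w : L2 n) : Prop :=
  w ∈ initialSpace φ ∧ ∀ f ∈ initialSpace φ, inner ℂ (shift (unit j) f) w = 0

lemma IsWandering.add {φ : LInfty n} {j : Fin n} {v w : L2 n} (hv : IsWandering φ j v)
    (hw : IsWandering φ j w) : IsWandering φ j (v + w) :=
  ⟨Submodule.add_mem _ hv.1 hw.1, fun f hf => by
    rw [inner_add_right, hv.2 f hf, hw.2 f hf, add_zero]⟩

/-- This and the next lemma give the two sources of wandering vectors; `IsWandering.exists_add`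
shows that their sums are all of them. -/
lemma isWandering_of_indep {φ : LInfty n} {j : Fin n} {a : L2 n} (ha : a ∈ initialSpace φ)
    (ha' : a ∈ indep j) : IsWandering φ j a :=
  ⟨ha, fun _ hf => inner_shift_indep ha' hf.1⟩

lemma isWandering_of_laurent_indep {φ : LInfty n} (hφ : Unimodular φ) {j : Fin n} {c : L2 n}
    (hc : c ∈ initialSpace φ) (hc' : laurent φ c ∈ indep j) : IsWandering φ j c :=
  ⟨hc, fun f hf => by
    rw [← inner_laurent_laurent hφ, laurent_shift]
    exact inner_shift_indep hc' hf.2⟩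

/-- The condition, for a unimodular symbol, that the Toeplitz operator be a partial isometry: the
Hardy space is spanned by the functions mapped by `φ` into it and those mapped by `φ` into its
orthogonal complement. -/
def Splits (φ : LInfty n) : Prop :=
  ∀ f ∈ hardy n, ∃ m ∈ initialSpace φ, laurent φ (f - m) ∈ (hardy n)ᗮ

/-- Remove from `w` its projection `c` onto the vectors of M whose product with φ is independent of
z_j. The remainder is orthogonal to z_j H²: for `g ∈ H²`, `Splits` is used once on `g` and again on
z_j times its kernel part, and each of the three resulting pieces is orthogonal to `w - c` for its
own reason. -/
lemma IsWandering.exists_add {φ : LInfty n} (hφ : Unimodular φ) (hs : Splits φ) {j : Fin n}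
    {w : L2 n} (hw : IsWandering φ j w) :
    ∃ a c, w = a + c ∧ a ∈ initialSpace φ ∧ a ∈ indep j ∧ c ∈ initialSpace φ ∧
      laurent φ c ∈ indep j := by
  let C : Submodule ℂ (L2 n) :=
    initialSpace φ ⊓ (indep j).comap (laurent φ : L2 n →ₗ[ℂ] L2 n)
  have hC : IsClosed (C : Set (L2 n)) :=
    (isClosed_initialSpace φ).inter ((isClosed_spec _).preimage (laurent φ).continuous)
  have : CompleteSpace C := hC.completeSpace_coe
  let c := C.starProjection w
  have hc : c ∈ C := Submodule.starProjection_apply_mem _ _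
  have hcw : IsWandering φ j c := isWandering_of_laurent_indep hφ hc.1 hc.2
  have ha : w - c ∈ initialSpace φ := Submodule.sub_mem _ hw.1 hc.1
  refine ⟨w - c, c, by abel, ha, mem_indep_of_inner ha.1 fun g hg => ?_, hc.1, hc.2⟩
  -- split `g = m + (g - m)` along the initial space and the kernel
  obtain ⟨m, hm, hgm⟩ := hs g hg
  have h1 : inner ℂ (shift (unit j) m) (w - c) = 0 := by
    rw [inner_sub_right, hw.2 m hm, hcw.2 m hm, sub_zero]
  obtain ⟨u, hu, hgu⟩ := hs (shift (unit j) (g - m))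
    (shift_mem_hardy (unit_nonneg j) (Submodule.sub_mem _ hg hm.1))
  -- On ℕⁿ the coefficients of φu agree with those of z_j φ(g - m). The function φ(g - m) has none
  -- on ℕⁿ, so after the shift only those with `k j = 0` can survive.
  have huC : u ∈ C := by
    refine ⟨hu, fun k hk => ?_⟩
    by_cases hpos : ∀ i, 0 ≤ k i
    · have hkj : 0 < k j := lt_of_le_of_ne (hpos j) fun h0 => hk ⟨hpos, h0.symm⟩
      have h2 := mem_hardy_orthogonal.1 hgu k hpos
      rw [map_sub, coef_sub, laurent_shift, coef_shift, mem_hardy_orthogonal.1 hgm, zero_sub,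
        neg_eq_zero] at h2
      · exact h2
      · intro i
        by_cases hij : i = j
        · subst hij
          simp only [Pi.sub_apply, Pi.single_eq_same]
          omega
        · simpa [hij] using hpos i
    · push Not at hpos
      exact mem_hardy.1 hu.2 k hpos
  have h2 : inner ℂ u (w - c) = 0 :=
    (Submodule.mem_orthogonal _ _).1 (Submodule.sub_starProjection_mem_orthogonal w) u huC
  -- Multiplication by φ preserves inner products; it sends the left vector into (H²)ᗮ and the right
  -- one into H².
  have h3 : inner ℂ (shift (unit j) (g - m) - u) (w - c) = 0 := by
    rw [← inner_laurent_laurent hφ]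
    exact (Submodule.mem_orthogonal' _ _).1 hgu _ ha.2
  calc inner ℂ (shift (unit j) g) (w - c)
      = inner ℂ (shift (unit j) m + (shift (unit j) (g - m) - u) + u) (w - c) := by
        congr 1
        rw [map_sub]
        abel
    _ = 0 := by rw [inner_add_left, inner_add_left, h1, h2, h3, add_zero, add_zero]

/-- The shifts on the initial space are doubly commuting. -/
lemma IsWandering.shift {φ : LInfty n} (hφ : Unimodular φ) (hs : Splits φ) {j : Fin n}
    {w : L2 n} (hw : IsWandering φ j w) {k : Fin n → ℤ} (hk : ∀ i, 0 ≤ k i) (hkj : k j = 0) :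
    IsWandering φ j (shift k w) := by
  -- Multiplication by z^k with `k j = 0` keeps independence of z_j and commutes with φ, so both
  -- kinds of summand survive.
  obtain ⟨a, c, rfl, ha, ha', hc, hc'⟩ := hw.exists_add hφ hs
  rw [map_add]
  refine (isWandering_of_indep (shift_mem_initialSpace hk ha) (shift_mem_indep hk hkj ha')).add
    (isWandering_of_laurent_indep hφ (shift_mem_initialSpace hk hc) ?_)
  rw [laurent_shift]
  exact shift_mem_indep hk hkj hc'

/-- If `w` is wandering for all variables, then `conj w * f` is in the Hardy space for `f` in the
initial space. -/
lemma inner_shift_wandering {φ : LInfty n} (hφ : Unimodular φ) (hs : Splits φ) {w f : L2 n}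
    {j : Fin n} (hw : IsWandering φ j w) (hf : f ∈ initialSpace φ) {k : Fin n → ℤ}
    (hk : k j < 0) : inner ℂ (Polydisc.shift k w) f = 0 := by
  -- The positive part of `k` does not involve z_j and keeps `w` wandering; the negative part, moved
  -- onto `f`, contains a factor z_j.
  have hdecomp : k = -(fun i => (k i)⁻) + fun i => (k i)⁺ := by
    funext i
    simp only [Pi.add_apply, Pi.neg_apply]
    have := posPart_sub_negPart (k i)
    omega
  have h1 : IsWandering φ j (Polydisc.shift (fun i => (k i)⁺) w) :=
    hw.shift hφ hs (fun i => posPart_nonneg _) (posPart_eq_zero.2 hk.le)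
  have h2 : Polydisc.shift (fun i => (k i)⁻) f =
      Polydisc.shift (unit j) (Polydisc.shift ((fun i => (k i)⁻) - unit j) f) := by
    rw [shift_shift, add_sub_cancel]
  have h3 : Polydisc.shift ((fun i => (k i)⁻) - unit j) f ∈ initialSpace φ := by
    refine shift_mem_initialSpace (fun i => ?_) hf
    by_cases hij : i = j
    · subst hij
      have : (k i)⁻ = - k i := negPart_of_nonpos hk.le
      simp only [Pi.sub_apply, Pi.single_eq_same]
      omega
    · simp [hij]
  rw [hdecomp, ← shift_shift, inner_shift_left, neg_neg, h2, ← inner_conj_symm, h1.2 _ h3, map_zero]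

/-- Take a frequency `k` of least total degree among all coefficients occurring in M. The projection
of z^k to M represents the functional `coef · k` on M. That functional kills z_j M, because the
coefficient of z_j g at `k` is one of `g` of lower degree. -/
lemma exists_wandering {φ : LInfty n} (hM : ∃ f ∈ initialSpace φ, f ≠ 0) :
    ∃ w ≠ 0, ∀ j, IsWandering φ j w := by
  have : CompleteSpace (initialSpace φ) := (isClosed_initialSpace φ).completeSpace_coe
  let p (d : ℕ) : Prop :=
    ∃ f ∈ initialSpace φ, ∃ k : Fin n → ℤ, coef f k ≠ 0 ∧ (∑ i, k i).toNat = d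
  have hp : ∃ d, p d := by
    obtain ⟨f, hf, hf0⟩ := hM
    by_contra hcon
    refine hf0 (ext_coef fun k => ?_)
    rw [coef_zero]
    by_contra hk
    exact hcon ⟨_, f, hf, k, hk, rfl⟩
  classical
  obtain ⟨f, hf, k, hk, hd⟩ := Nat.find_spec hp
  have hkpos : ∀ i, 0 ≤ k i := by
    by_contra h
    push Not at h
    exact hk (mem_hardy.1 hf.1 k h)
  have hproj {g : L2 n} (hg : g ∈ initialSpace φ) :
      inner ℂ ((initialSpace φ).starProjection (monomial k)) g = coef g k := by
    rw [Submodule.inner_starProjection_left_eq_right, Submodule.starProjection_eq_self_iff.2 hg,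
      coef]
  refine ⟨(initialSpace φ).starProjection (monomial k), fun h => hk ?_, fun j =>
    ⟨Submodule.starProjection_apply_mem _ _, fun g hg => ?_⟩⟩
  · rw [← hproj hf, h, inner_zero_left]
  · rw [← inner_conj_symm, hproj (shift_mem_initialSpace (unit_nonneg j) hg), coef_shift]
    by_contra hne
    rw [map_eq_zero] at hne
    by_cases hneg : ∃ i, (k - unit j) i < 0
    · exact hne (mem_hardy.1 hg.1 _ hneg)
    · push Not at hneg
      refine Nat.find_min hp (m := (∑ i, (k - unit j) i).toNat) ?_ ⟨g, hg, _, hne, rfl⟩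
      rw [← hd]
      have h0 : 0 ≤ ∑ i, (k - unit j) i := Finset.sum_nonneg fun i _ => hneg i
      have h1 : ∑ i, (k - unit j) i = ∑ i, k i - 1 := by
        simp [Finset.sum_sub_distrib]
      omega

/-- A function in `L²` of modulus one, as an element of `L^∞`. -/
lemma exists_toL2_eq {f : L2 n} (hf : ∀ᵐ t ∂torusMeasure n, ‖f t‖ = 1) :
    ∃ ψ : LInfty n, Unimodular ψ ∧ toL2 ψ = f := by
  have h : MemLp f ∞ (torusMeasure n) :=
    memLp_top_of_bound (Lp.aestronglyMeasurable f) 1 (hf.mono fun t ht => ht.le)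
  refine ⟨h.toLp, ?_, Lp.ext ?_⟩
  · filter_upwards [hf, h.coeFn_toLp] with t h1 h2
    rw [h2, h1]
  · filter_upwards [coeFn_toL2 h.toLp, h.coeFn_toLp] with t h1 h2
    rw [h1, h2]

/-- A Beurling type theorem for the initial space. -/
theorem exists_wandering_unimodular {φ : LInfty n} (hφ : Unimodular φ) (hs : Splits φ)
    (hM : ∃ f ∈ initialSpace φ, f ≠ 0) :
    ∃ ψ : LInfty n, Unimodular ψ ∧ (∀ j, IsWandering φ j (toL2 ψ)) ∧
      toL2 ψ ∈ initialSpace φ := by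
  obtain ⟨w, hw0, hw, hwM⟩ : ∃ w ≠ 0, (∀ j, IsWandering φ j w) ∧ w ∈ initialSpace φ := by
    -- For n = 0 being wandering for all `j` is vacuous and does not give membership in M.
    rcases isEmpty_or_nonempty (Fin n) with h | ⟨⟨j⟩⟩
    · obtain ⟨f, hf, hf0⟩ := hM
      exact ⟨f, hf0, fun j => h.elim j, hf⟩
    · obtain ⟨w, hw0, hw⟩ := exists_wandering hM
      exact ⟨w, hw0, hw, (hw j).1⟩
  have hneg {k : Fin n → ℤ} (h : ∃ j, k j < 0) : inner ℂ (shift k w) w = 0 := by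
    obtain ⟨j, hj⟩ := h
    exact inner_shift_wandering hφ hs (hw j) hwM hj
  -- A nonzero frequency has a negative entry or its opposite does.
  have hmod := norm_eq_of_inner_shift (f := w) fun k hk => by
    by_cases h : ∃ j, k j < 0
    · exact hneg h
    · rw [inner_shift_left, ← inner_conj_symm, hneg, map_zero]
      push Not at h
      obtain ⟨i, hi⟩ := Function.ne_iff.1 hk
      exact ⟨i, neg_neg_of_pos (lt_of_le_of_ne (h i) (Ne.symm hi))⟩
  have hc : (‖w‖ : ℂ)⁻¹ ≠ 0 := inv_ne_zero (by simpa using hw0)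
  obtain ⟨ψ, hψ, hψw⟩ := exists_toL2_eq (f := (‖w‖ : ℂ)⁻¹ • w) (by
    filter_upwards [hmod, Lp.coeFn_smul (‖w‖ : ℂ)⁻¹ w] with t h1 h2
    rw [h2, Pi.smul_apply, norm_smul, h1, norm_inv, Complex.norm_real, norm_norm]
    exact inv_mul_cancel₀ (by simpa using hw0))
  refine ⟨ψ, hψ, fun j => ?_, ?_⟩
  · rw [hψw]
    exact ⟨Submodule.smul_mem _ _ (hw j).1, fun f hf => by
      rw [inner_smul_right, (hw j).2 f hf, mul_zero]⟩
  · rw [hψw]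
    exact Submodule.smul_mem _ _ hwM

end Polydisc
end

noncomputable section

namespace Polydisc

open UnitAddTorus ComplexConjugate

variable {n : ℕ}

/-! ### Translations and functions independent of a variable -/

lemma measurePreserving_add (σ : UnitAddTorus (Fin n)) :
    MeasurePreserving (fun t => t + σ) (torusMeasure n) (torusMeasure n) :=
  measurePreserving_add_right _ _

/-- Translation of a function on the torus. -/
def translate (σ : UnitAddTorus (Fin n)) (f : L2 n) : L2 n :=
  Lp.compMeasurePreserving (fun t => t + σ) (measurePreserving_add σ) f

lemma coeFn_translate (σ : UnitAddTorus (Fin n)) (f : L2 n) :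
    translate σ f =ᵐ[torusMeasure n] fun t => f (t + σ) :=
  Lp.coeFn_compMeasurePreserving f (measurePreserving_add σ)

lemma mFourier_add_apply (k : Fin n → ℤ) (s t : UnitAddTorus (Fin n)) :
    mFourier k (s + t) = mFourier k s * mFourier k t := by
  simp only [mFourier, ContinuousMap.coe_mk, Pi.add_apply, ← Finset.prod_mul_distrib]
  exact Finset.prod_congr rfl fun i _ => by simp [fourier_apply, AddCircle.toCircle_add]

lemma mFourier_neg_mul_self (k : Fin n → ℤ) (t : UnitAddTorus (Fin n)) :
    mFourier (-k) t * mFourier k t = 1 := by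
  rw [← mFourier_add, neg_add_cancel, mFourier_zero, ContinuousMap.one_apply]

lemma coef_translate (σ : UnitAddTorus (Fin n)) (f : L2 n) (k : Fin n → ℤ) :
    coef (translate σ f) k = mFourier k σ * coef f k := by
  have h := (measurePreserving_add σ).integral_comp
    (measurableEmbedding_addRight σ) (fun t => mFourier (-k) t * f t)
  rw [coef_eq_integral, coef_eq_integral, ← h, ← integral_const_mul]
  refine integral_congr_ae ?_
  filter_upwards [coeFn_translate σ f] with t ht
  rw [ht, mFourier_add_apply]
  linear_combination (-(mFourier (-k) t * f (t + σ))) * mFourier_neg_mul_self k σ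

lemma mFourier_pi_single (k : Fin n → ℤ) (j : Fin n) (s : UnitAddCircle) :
    mFourier k (Pi.single j s) = fourier (k j) s := by
  simp only [mFourier, ContinuousMap.coe_mk]
  rw [Finset.prod_eq_single j (fun i _ hij => by simp [hij]) (by simp), Pi.single_eq_same]

/-- Independence of z_j is restated as invariance under translation in that coordinate (converse in
`coef_eq_zero_of_translate`), a pointwise condition that passes to quotients. -/
lemma translate_of_mem_indep {j : Fin n} {f : L2 n} (hf : f ∈ indep j) (s : UnitAddCircle) :
    translate (Pi.single j s) f = f := by
  refine ext_coef fun k => ?_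
  rw [coef_translate, mFourier_pi_single]
  by_cases hk : k ∈ {k : Fin n → ℤ | (∀ i, 0 ≤ k i) ∧ k j = 0}
  · rw [hk.2, fourier_zero, one_mul]
  · rw [hf k hk, mul_zero]

lemma mem_indep_iff {j : Fin n} {f : L2 n} (hf : f ∈ hardy n) :
    f ∈ indep j ↔ ∀ k, k j ≠ 0 → coef f k = 0 := by
  refine ⟨fun h k hk => h k fun hk' => hk hk'.2, fun h k hk => ?_⟩
  by_cases hpos : ∀ i, 0 ≤ k i
  · exact h k fun h0 => hk ⟨hpos, h0⟩
  · push Not at hpos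
    exact mem_hardy.1 hf k hpos

lemma exists_fourier_ne_one {k : ℤ} (hk : k ≠ 0) : ∃ s : UnitAddCircle, fourier k s ≠ 1 := by
  refine ⟨0 + ((1 / 2 / k : ℝ) : UnitAddCircle), ?_⟩
  rw [fourier_add_half_inv_index hk one_pos, fourier_eval_zero]
  norm_num

lemma coef_eq_zero_of_translate {f : L2 n} {j : Fin n}
    (h : ∀ s, translate (Pi.single j s) f = f) {k : Fin n → ℤ} (hk : k j ≠ 0) :
    coef f k = 0 := by
  obtain ⟨s, hs⟩ := exists_fourier_ne_one hk
  have h1 := coef_translate (Pi.single j s) f k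
  rw [h s, mFourier_pi_single] at h1
  by_contra hne
  exact hs (mul_right_cancel₀ hne (by rw [← h1, one_mul]))

/-- If a nonzero function independent of a variable times `ψ` is independent of that variable, so
is `ψ`. -/
lemma indep_of_laurent_indep {ψ : LInfty n} (hψ : toL2 ψ ∈ hardy n) {j : Fin n} {h : L2 n}
    (hh : h ∈ indep j) (hh0 : h ≠ 0) (ha : laurent ψ h ∈ indep j) : toL2 ψ ∈ indep j := by
  -- Almost everywhere ψ is the quotient of ψh by `h`, both invariant under the translation, and `h`
  -- is nonzero almost everywhere.
  refine (mem_indep_iff hψ).2 fun k hk => coef_eq_zero_of_translate (fun s => Lp.ext ?_) hk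
  set σ : UnitAddTorus (Fin n) := Pi.single j s
  have h1 := coeFn_translate σ (laurent ψ h)
  rw [translate_of_mem_indep ha] at h1
  have h2 := coeFn_translate σ h
  rw [translate_of_mem_indep hh] at h2
  filter_upwards [h1, h2, coeFn_translate σ (toL2 ψ), coeFn_laurent ψ h,
    (measurePreserving_add σ).quasiMeasurePreserving.ae (coeFn_laurent ψ h), coeFn_toL2 ψ,
    (measurePreserving_add σ).quasiMeasurePreserving.ae (coeFn_toL2 ψ),
    ae_ne_zero_of_mem_hardy (indep_le_hardy j hh) hh0] with t e1 e2 e3 e4 e5 e6 e7 e8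
  rw [e3, e6, e7]
  refine mul_right_cancel₀ e8 ?_
  rw [← e4, e1, e5, e2]

lemma laurent_of_toL2_eq {φ ψ ζ : LInfty n} (h : toL2 ζ = laurent φ (toL2 ψ)) (f : L2 n) :
    laurent ζ f = laurent φ (laurent ψ f) := by
  refine Lp.ext ?_
  have h1 := coeFn_toL2 ζ
  rw [h] at h1
  filter_upwards [h1, coeFn_laurent φ (toL2 ψ), coeFn_toL2 ψ, coeFn_laurent ζ f,
    coeFn_laurent φ (laurent ψ f), coeFn_laurent ψ f] with t e1 e2 e3 e4 e5 e6
  rw [e4, e5, e6, ← e1, e2, e3, mul_assoc]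

/-- Take ψ wandering in M and ζ = φψ. If M contains some `a ≠ 0` independent of z_j, then ψ̄a is
independent of z_j as well, hence so is ψ. Otherwise the first summand in the splitting of ψ is
zero, which makes ζ independent of z_j. -/
theorem exists_factorization {φ : LInfty n} (hφ : Unimodular φ) (hs : Splits φ)
    (hM : ∃ f ∈ initialSpace φ, f ≠ 0) :
    ∃ ψ ζ : LInfty n, Unimodular ψ ∧ Unimodular ζ ∧ toL2 ψ ∈ hardy n ∧ toL2 ζ ∈ hardy n ∧
      (∀ f, laurent φ f = laurent (star ψ) (laurent ζ f)) ∧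
      ∀ j, toL2 ψ ∈ indep j ∨ toL2 ζ ∈ indep j := by
  obtain ⟨ψ, hψ, hψw, hψM⟩ := exists_wandering_unimodular hφ hs hM
  obtain ⟨ζ, hζ, hζψ⟩ := exists_toL2_eq (f := laurent φ (toL2 ψ)) (by
    filter_upwards [coeFn_laurent φ (toL2 ψ), coeFn_toL2 ψ, hφ, hψ] with t h1 h2 h3 h4
    rw [h1, h2, norm_mul, h3, h4, one_mul])
  have hlaur := laurent_of_toL2_eq hζψ
  refine ⟨ψ, ζ, hψ, hζ, hψM.1, ?_, fun f => ?_, fun j => ?_⟩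
  · rw [hζψ]
    exact hψM.2
  · rw [hlaur, laurent_comm φ ψ, laurent_star_laurent hψ]
  by_cases h : ∃ a ∈ initialSpace φ, a ∈ indep j ∧ a ≠ 0
  · left
    obtain ⟨a, haM, haj, ha0⟩ := h
    have hψa : laurent ψ (laurent (star ψ) a) = a := laurent_laurent_star hψ a
    -- The coefficient of ψ̄a at `k` is ⟨z^k ψ, a⟩. It vanishes for a negative entry since ψ is
    -- wandering, and for `k j > 0` since `a` is orthogonal to z_j H².
    refine indep_of_laurent_indep hψM.1 (h := laurent (star ψ) a) (fun k hk => ?_) ?_ ?_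
    · rw [coef, ← inner_laurent, laurent_monomial]
      by_cases hneg : ∃ i, k i < 0
      · obtain ⟨i, hi⟩ := hneg
        exact inner_shift_wandering hφ hs (hψw i) haM hi
      · push Not at hneg
        have hkj : 0 < k j := lt_of_le_of_ne (hneg j) fun h0 => hk ⟨hneg, h0.symm⟩
        have : k = unit j + (k - unit j) := (add_sub_cancel _ _).symm
        rw [this, ← shift_shift]
        refine inner_shift_indep haj (shift_mem_hardy (fun i => ?_) hψM.1)
        by_cases hij : i = j
        · subst hij
          simp only [Pi.sub_apply, Pi.single_eq_same]
          omega
        · simpa [hij] using hneg i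
    · intro h0
      rw [h0, map_zero] at hψa
      exact ha0 hψa.symm
    · rwa [hψa]
  · right
    obtain ⟨a, c, hac, haM, haj, -, hc⟩ := (hψw j).exists_add hφ hs
    have ha0 : a = 0 := by
      by_contra ha0
      exact h ⟨a, haM, haj, ha0⟩
    rwa [hζψ, hac, ha0, zero_add]

/-! ### Toeplitz operators with analytic symbols -/

lemma laurent_mem_hardy {ψ : LInfty n} (hψ : toL2 ψ ∈ hardy n) {f : L2 n} (hf : f ∈ hardy n) :
    laurent ψ f ∈ hardy n := by
  rintro k ⟨i, hi⟩
  refine coef_laurent_eq_zero fun m => ?_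
  by_cases hm : m i < 0
  · exact Or.inr (mem_hardy.1 hf m ⟨i, hm⟩)
  · refine Or.inl (mem_hardy.1 hψ _ ⟨i, ?_⟩)
    simp only [Pi.sub_apply]
    omega

lemma toeplitz_apply_of_mem_hardy {ψ : LInfty n} (hψ : toL2 ψ ∈ hardy n) (f : hardy n) :
    (toeplitz ψ f : L2 n) = laurent ψ f :=
  Submodule.starProjection_eq_self_iff.2 (laurent_mem_hardy hψ f.2)

lemma inner_toeplitz (φ : LInfty n) (g f : hardy n) :
    inner ℂ g (toeplitz φ f) = inner ℂ (g : L2 n) (laurent φ f) := by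
  rw [Submodule.coe_inner, toeplitz_apply, ← Submodule.inner_starProjection_left_eq_right,
    Submodule.starProjection_eq_self_iff.2 g.2]

lemma adjoint_toeplitz (φ : LInfty n) :
    ContinuousLinearMap.adjoint (toeplitz φ) = toeplitz (star φ) := by
  refine ((ContinuousLinearMap.eq_adjoint_iff _ _).2 fun f g => ?_).symm
  rw [inner_toeplitz, ← inner_conj_symm, inner_toeplitz, inner_conj_symm, inner_laurent, star_star]

lemma toeplitz_eq_adjoint_comp {φ ψ ζ : LInfty n} (hζ : toL2 ζ ∈ hardy n)
    (h : ∀ f, laurent φ f = laurent (star ψ) (laurent ζ f)) :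
    toeplitz φ = ContinuousLinearMap.adjoint (toeplitz ψ) ∘L toeplitz ζ := by
  refine ContinuousLinearMap.ext fun f => ext_inner_left ℂ fun g => ?_
  rw [inner_toeplitz, ContinuousLinearMap.comp_apply, adjoint_toeplitz, inner_toeplitz,
    toeplitz_apply_of_mem_hardy hζ, h]

/-- Analytic and coanalytic Toeplitz operators with symbols in disjoint sets of variables commute. -/
lemma toeplitz_adjoint_comm {ψ ζ : LInfty n} (hψ : toL2 ψ ∈ hardy n) (hζ : toL2 ζ ∈ hardy n)
    (h : ∀ j, toL2 ψ ∈ indep j ∨ toL2 ζ ∈ indep j) (f : hardy n) :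
    ContinuousLinearMap.adjoint (toeplitz ψ) (toeplitz ζ f) =
      toeplitz ζ (ContinuousLinearMap.adjoint (toeplitz ψ) f) := by
  refine ext_inner_left ℂ fun g => ?_
  rw [adjoint_toeplitz, inner_toeplitz, toeplitz_apply_of_mem_hardy hζ, inner_toeplitz,
    toeplitz_apply, laurent_comm, ← sub_eq_zero, ← inner_sub_right, ← map_sub]
  set u := laurent (star ψ) (f : L2 n)
  -- The two sides differ by the projection of ζ(u - Pu). A frequency `m` of u - Pu has some `m i <
  -- 0`. If ψ is independent of z_i, then `u` has no such frequency; if ζ is, then it cannot move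
  -- `m` to a `k` with `k i ≥ 0`.
  refine (Submodule.mem_orthogonal _ _).1 (mem_hardy_orthogonal.2 fun k hk => ?_) _ g.2
  refine coef_laurent_eq_zero fun m => ?_
  by_cases hm : ∀ i, 0 ≤ m i
  · right
    rw [coef_sub, coef_proj u hm, sub_self]
  push Not at hm
  obtain ⟨i, hi⟩ := hm
  rcases h i with hi' | hi'
  · right
    rw [coef_sub, mem_hardy.1 (Submodule.starProjection_apply_mem _ _) m ⟨i, hi⟩, sub_zero]
    refine coef_laurent_eq_zero fun l => ?_
    by_cases hl : l i < 0
    · exact Or.inr (mem_hardy.1 f.2 l ⟨i, hl⟩)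
    · left
      rw [coef_star, (mem_indep_iff hψ).1 hi', map_zero]
      simp only [Pi.neg_apply, Pi.sub_apply]
      omega
  · left
    refine (mem_indep_iff hζ).1 hi' _ ?_
    have := hk i
    simp only [Pi.sub_apply]
    omega

lemma norm_toeplitz {ψ : LInfty n} (hψ : toL2 ψ ∈ hardy n) (h1 : Unimodular ψ) (f : hardy n) :
    ‖toeplitz ψ f‖ = ‖f‖ := by
  rw [← Submodule.norm_coe, toeplitz_apply_of_mem_hardy hψ, norm_laurent h1, Submodule.norm_coe]

lemma adjoint_toeplitz_toeplitz {ψ : LInfty n} (hψ : toL2 ψ ∈ hardy n) (h1 : Unimodular ψ)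
    (f : hardy n) : ContinuousLinearMap.adjoint (toeplitz ψ) (toeplitz ψ f) = f := by
  refine ext_inner_left ℂ fun g => ?_
  rw [adjoint_toeplitz, inner_toeplitz, toeplitz_apply_of_mem_hardy hψ, laurent_star_laurent h1,
    Submodule.coe_inner]

/-- Since A*B = BA*, the vector x - AA*x is in the kernel. For `x` orthogonal to the kernel this
gives ‖x‖ = ‖A*x‖, and `B` preserves that norm. -/
lemma isPartialIsometry_adjoint_comp {H : Type*} [NormedAddCommGroup H] [InnerProductSpace ℂ H]
    [CompleteSpace H] {A B : H →L[ℂ] H} (hA : ∀ x, ContinuousLinearMap.adjoint A (A x) = x)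
    (hB : ∀ x, ‖B x‖ = ‖x‖)
    (hAB : ∀ x, ContinuousLinearMap.adjoint A (B x) = B (ContinuousLinearMap.adjoint A x)) :
    IsPartialIsometry (ContinuousLinearMap.adjoint A ∘L B) := by
  intro x hx
  have h0 : inner ℂ (x - A (ContinuousLinearMap.adjoint A x)) x = 0 := by
    refine (Submodule.mem_orthogonal _ _).1 hx _ ?_
    rw [LinearMap.mem_ker]
    refine (hAB _).trans ?_
    rw [map_sub, hA, sub_self, map_zero]
  rw [ContinuousLinearMap.comp_apply, hAB, hB, norm_eq_sqrt_re_inner (𝕜 := ℂ) x,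
    norm_eq_sqrt_re_inner (𝕜 := ℂ) (ContinuousLinearMap.adjoint A x)]
  rw [inner_sub_left, sub_eq_zero] at h0
  rw [h0, ContinuousLinearMap.adjoint_inner_right]

theorem isPartialIsometry_of_factorization {ψ ζ : LInfty n} (hψ : toL2 ψ ∈ hardy n)
    (hζ : toL2 ζ ∈ hardy n) (hψ1 : Unimodular ψ) (hζ1 : Unimodular ζ)
    (h : ∀ j, toL2 ψ ∈ indep j ∨ toL2 ζ ∈ indep j) :
    IsPartialIsometry (ContinuousLinearMap.adjoint (toeplitz ψ) ∘L toeplitz ζ) :=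
  isPartialIsometry_adjoint_comp (adjoint_toeplitz_toeplitz hψ hψ1) (norm_toeplitz hζ hζ1)
    (toeplitz_adjoint_comm hψ hζ h)

end Polydisc
end

noncomputable section

namespace Polydisc

open UnitAddTorus ComplexConjugate

variable {n : ℕ}

/-! ### Partially isometric Toeplitz operators have unimodular symbols -/

lemma exists_mem_ker_orthogonal {H : Type*} [NormedAddCommGroup H] [InnerProductSpace ℂ H]
    [CompleteSpace H] (T : H →L[ℂ] H) (x : H) : ∃ m ∈ T.kerᗮ, T (x - m) = 0 ∧ ‖m‖ ≤ ‖x‖ := by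
  have : CompleteSpace T.ker := (T.isClosed_ker).completeSpace_coe
  refine ⟨T.kerᗮ.starProjection x, Submodule.starProjection_apply_mem _ _, ?_,
    Submodule.norm_starProjection_apply_le _ _⟩
  rw [Submodule.starProjection_orthogonal_val, sub_sub_cancel]
  exact LinearMap.mem_ker.1 (Submodule.starProjection_apply_mem T.ker x)

lemma IsPartialIsometry.norm_apply_le {H : Type*} [NormedAddCommGroup H] [InnerProductSpace ℂ H]
    [CompleteSpace H] {T : H →L[ℂ] H} (hT : IsPartialIsometry T) (x : H) : ‖T x‖ ≤ ‖x‖ := by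
  obtain ⟨m, hm, hxm, hle⟩ := exists_mem_ker_orthogonal T x
  rw [map_sub, sub_eq_zero] at hxm
  rw [hxm, hT m hm]
  exact hle

/-- A trigonometric polynomial is shifted into the Hardy space by monomials of large degree. -/
lemma exists_shift_mem_hardy {p : L2 n} (hp : p ∈ Submodule.span ℂ (Set.range (basis n))) :
    ∃ N : ℤ, ∀ M ≥ N, shift (fun _ => M) p ∈ hardy n := by
  induction hp using Submodule.span_induction with
  | mem x hx =>
    obtain ⟨k, rfl⟩ := hx
    refine ⟨∑ i, |k i|, fun M hM => ?_⟩
    rw [basis_apply, shift_monomial]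
    refine monomial_mem_hardy fun i => ?_
    have h1 : |k i| ≤ ∑ i, |k i| :=
      Finset.single_le_sum (f := fun i => |k i|) (fun i _ => abs_nonneg _) (Finset.mem_univ i)
    have h2 := neg_abs_le (k i)
    simp only [Pi.add_apply]
    omega
  | zero => exact ⟨0, fun M _ => by rw [map_zero]; exact Submodule.zero_mem _⟩
  | add x y _ _ hx hy =>
    obtain ⟨N₁, h₁⟩ := hx
    obtain ⟨N₂, h₂⟩ := hy
    refine ⟨max N₁ N₂, fun M hM => ?_⟩
    rw [map_add]
    exact Submodule.add_mem _ (h₁ M (le_of_max_le_left hM)) (h₂ M (le_of_max_le_right hM))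
  | smul c x _ hx =>
    obtain ⟨N, h⟩ := hx
    exact ⟨N, fun M hM => by rw [map_smul]; exact Submodule.smul_mem _ _ (h M hM)⟩

lemma mem_closure_span_basis (f : L2 n) :
    f ∈ closure (Submodule.span ℂ (Set.range (basis n)) : Set (L2 n)) := by
  rw [← Submodule.topologicalClosure_coe, (basis n).dense_span]
  trivial

/-- A bound for a Toeplitz operator is a bound for the corresponding Laurent operator. -/
lemma norm_laurent_le {φ : LInfty n} {C : ℝ} (hC : ∀ x, ‖toeplitz φ x‖ ≤ C * ‖x‖) (f : L2 n) :
    ‖laurent φ f‖ ≤ C * ‖f‖ := by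
  have h1 : ∀ p ∈ Submodule.span ℂ (Set.range (basis n)),
      ∀ q ∈ Submodule.span ℂ (Set.range (basis n)),
      ‖inner ℂ q (laurent φ p)‖ ≤ ‖q‖ * (C * ‖p‖) := by
    intro p hp q hq
    obtain ⟨N₁, hN₁⟩ := exists_shift_mem_hardy hp
    obtain ⟨N₂, hN₂⟩ := exists_shift_mem_hardy hq
    -- A common shift moves both polynomials into H² without changing norms or the pairing, which
    -- becomes a pairing with the Toeplitz operator.
    set k : Fin n → ℤ := fun _ => max N₁ N₂
    have hp' := hN₁ _ (le_max_left N₁ N₂)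
    have hq' := hN₂ _ (le_max_right N₁ N₂)
    rw [← inner_shift_shift k, ← laurent_shift]
    have heq := inner_toeplitz φ ⟨shift k q, hq'⟩ ⟨shift k p, hp'⟩
    rw [← heq]
    refine (norm_inner_le_norm (𝕜 := ℂ) (⟨shift k q, hq'⟩ : hardy n) _).trans ?_
    have hqn : ‖(⟨shift k q, hq'⟩ : hardy n)‖ = ‖q‖ := norm_shift k q
    have hpn : ‖(⟨shift k p, hp'⟩ : hardy n)‖ = ‖p‖ := norm_shift k p
    rw [hqn]
    refine mul_le_mul_of_nonneg_left ?_ (norm_nonneg _)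
    rw [← hpn]
    exact hC _
  have h2 : ∀ p ∈ Submodule.span ℂ (Set.range (basis n)), ∀ g : L2 n,
      ‖inner ℂ g (laurent φ p)‖ ≤ ‖g‖ * (C * ‖p‖) := by
    intro p hp g
    have hcl : IsClosed {g : L2 n | ‖inner ℂ g (laurent φ p)‖ ≤ ‖g‖ * (C * ‖p‖)} :=
      isClosed_le (by fun_prop) (by fun_prop)
    exact hcl.closure_subset_iff.2 (fun q hq => h1 p hp q hq) (mem_closure_span_basis g)
  have h3 : ∀ g : L2 n, ‖inner ℂ g (laurent φ f)‖ ≤ ‖g‖ * (C * ‖f‖) := by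
    intro g
    have hcl : IsClosed {f : L2 n | ‖inner ℂ g (laurent φ f)‖ ≤ ‖g‖ * (C * ‖f‖)} :=
      isClosed_le (by fun_prop) (by fun_prop)
    exact hcl.closure_subset_iff.2 (fun p hp => h2 p hp g) (mem_closure_span_basis f)
  rcases eq_or_ne (laurent φ f) 0 with h0 | h0
  · rw [h0, norm_zero]
    -- No sign is assumed for `C`, so `0 ≤ C * ‖f‖` is extracted from the bound itself.
    rcases eq_or_ne f 0 with rfl | hf
    · simp
    · have h4 := h3 f
      rw [h0, inner_zero_right, norm_zero] at h4
      exact nonneg_of_mul_nonneg_right h4 (norm_pos_iff.2 hf)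
  · have h4 := h3 (laurent φ f)
    rw [inner_self_eq_norm_sq_to_K] at h4
    norm_cast at h4
    rw [abs_of_nonneg (by positivity), sq] at h4
    exact le_of_mul_le_mul_left h4 (norm_pos_iff.2 h0)

/-- Tested on the indicator of {|φ| > 1}, contractivity leaves that set no mass. -/
lemma ae_norm_le_one {φ : LInfty n} (h : ∀ f, ‖laurent φ f‖ ≤ ‖f‖) :
    ∀ᵐ t ∂torusMeasure n, ‖φ t‖ ≤ 1 := by
  let S : Set (UnitAddTorus (Fin n)) := {t | 1 < ‖φ t‖}
  have hS : MeasurableSet S :=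
    measurableSet_lt measurable_const (Lp.stronglyMeasurable φ).measurable.norm
  have hχ : MemLp (S.indicator (1 : UnitAddTorus (Fin n) → ℂ)) 2 (torusMeasure n) :=
    (memLp_const (1 : ℂ)).indicator hS
  let f : L2 n := hχ.toLp
  have hint := (integrable_normSq (laurent φ f)).sub (integrable_normSq f)
  have hpt : ∀ᵐ t ∂torusMeasure n, ‖laurent φ f t‖ ^ 2 - ‖f t‖ ^ 2 =
      S.indicator (fun t => ‖φ t‖ ^ 2 - 1) t := by
    filter_upwards [coeFn_laurent φ f, hχ.coeFn_toLp] with t h1 h2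
    rw [h1, show f t = _ from h2]
    by_cases ht : t ∈ S <;> simp [ht]
  have hnn : 0 ≤ᵐ[torusMeasure n] fun t => ‖laurent φ f t‖ ^ 2 - ‖f t‖ ^ 2 := by
    filter_upwards [hpt] with t h1
    rw [h1]
    refine Set.indicator_nonneg (fun t ht => ?_) t
    have : 1 < ‖φ t‖ := ht
    nlinarith
  have hle : ∫ t, (‖laurent φ f t‖ ^ 2 - ‖f t‖ ^ 2) ∂torusMeasure n = 0 := by
    refine le_antisymm ?_ (integral_nonneg_of_ae hnn)
    rw [integral_sub (integrable_normSq _) (integrable_normSq _), integral_normSq, integral_normSq,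
      sub_nonpos]
    exact pow_le_pow_left₀ (norm_nonneg _) (h f) 2
  filter_upwards [(integral_eq_zero_iff_of_nonneg_ae hnn hint).1 hle, hpt] with t h1 h2
  by_contra ht
  have htS : t ∈ S := not_le.1 ht
  rw [h2, Set.indicator_of_mem htS] at h1
  have : 1 < ‖φ t‖ := htS
  have h3 : ‖φ t‖ ^ 2 - 1 = 0 := h1
  nlinarith

/-- For `x` in (ker T)ᗮ the chain ‖x‖ = ‖P(φx)‖ ≤ ‖φx‖ ≤ ‖x‖ is all equalities, so φx ∈ H². A single
nonzero such `x` forces |φ| = 1, and `Splits` is the decomposition of H² along ker T. -/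
theorem unimodular_of_isPartialIsometry {φ : LInfty n} (hφ0 : φ ≠ 0)
    (hT : IsPartialIsometry (toeplitz φ)) :
    Unimodular φ ∧ Splits φ ∧ ∃ f ∈ initialSpace φ, f ≠ 0 := by
  have hcontr : ∀ f, ‖laurent φ f‖ ≤ ‖f‖ := fun f => by
    simpa using norm_laurent_le (C := 1) (fun x => by simpa using hT.norm_apply_le x) f
  have hle := ae_norm_le_one hcontr
  have hmem {x : hardy n} (hx : x ∈ (toeplitz φ).kerᗮ) :
      ‖laurent φ (x : L2 n)‖ = ‖(x : L2 n)‖ ∧ (x : L2 n) ∈ initialSpace φ := by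
    have h1 : ‖(hardy n).starProjection (laurent φ (x : L2 n))‖ = ‖(x : L2 n)‖ := by
      rw [← toeplitz_apply, Submodule.norm_coe, Submodule.norm_coe]
      exact hT x hx
    have h2 := Submodule.norm_starProjection_apply_le (hardy n) (laurent φ (x : L2 n))
    have h3 := hcontr x
    have h4 : ‖laurent φ (x : L2 n)‖ = ‖(x : L2 n)‖ := le_antisymm h3 (h1 ▸ h2)
    have h5 : laurent φ (x : L2 n) ∈ hardy n :=
      (Submodule.mem_iff_norm_starProjection (hardy n) _).2 (h1.trans h4.symm)
    exact ⟨h4, x.2, h5⟩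
  obtain ⟨x, hx, hx0⟩ : ∃ x ∈ (toeplitz φ).kerᗮ, x ≠ 0 := by
    by_contra! hbot
    have hker : ∀ x, toeplitz φ x = 0 := fun x => by
      obtain ⟨m, hm, hxm, -⟩ := exists_mem_ker_orthogonal (toeplitz φ) x
      rwa [hbot m hm, sub_zero] at hxm
    refine hφ0 ?_
    -- A zero Toeplitz operator has a zero symbol: the norm comparison with `C = 0`.
    have h0 : toL2 φ = 0 := by
      have := norm_laurent_le (φ := φ) (C := 0) (fun x => by rw [hker x]; simp) (monomial 0)
      rw [zero_mul] at this
      exact norm_le_zero_iff.1 this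
    refine Lp.ext ?_
    have h1 := coeFn_toL2 φ
    rw [h0] at h1
    filter_upwards [h1, Lp.coeFn_zero ℂ 2 (torusMeasure n), Lp.coeFn_zero ℂ ∞ (torusMeasure n)]
      with t e1 e2 e3
    rw [← e1, e2, e3]
  obtain ⟨hxn, hxM⟩ := hmem hx
  have hx0' : (x : L2 n) ≠ 0 := fun h => hx0 (Subtype.ext h)
  -- The integral of (1 - |φ|²)|x|² is zero with nonnegative integrand, and `x` is nonzero almost
  -- everywhere.
  have huni : Unimodular φ := by
    have hint := (integrable_normSq (x : L2 n)).sub (integrable_normSq (laurent φ (x : L2 n)))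
    have hnn : 0 ≤ᵐ[torusMeasure n]
        fun t => ‖(x : L2 n) t‖ ^ 2 - ‖laurent φ (x : L2 n) t‖ ^ 2 := by
      filter_upwards [hle, coeFn_laurent φ (x : L2 n)] with t h1 h2
      rw [h2, norm_mul]
      have h3 := mul_le_of_le_one_left (norm_nonneg ((x : L2 n) t)) h1
      exact sub_nonneg.2 (pow_le_pow_left₀ (by positivity) h3 2)
    have h0 : ∫ t, (‖(x : L2 n) t‖ ^ 2 - ‖laurent φ (x : L2 n) t‖ ^ 2) ∂torusMeasure n = 0 := by
      rw [integral_sub (integrable_normSq _) (integrable_normSq _), integral_normSq,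
        integral_normSq, hxn, sub_self]
    filter_upwards [(integral_eq_zero_iff_of_nonneg_ae hnn hint).1 h0, coeFn_laurent φ (x : L2 n),
      ae_ne_zero_of_mem_hardy x.2 hx0'] with t h1 h2 h3
    have h4 : ‖(x : L2 n) t‖ ^ 2 - ‖laurent φ (x : L2 n) t‖ ^ 2 = 0 := h1
    rw [h2, norm_mul, mul_pow] at h4
    have h5 : ‖φ t‖ ^ 2 = 1 :=
      mul_right_cancel₀ (pow_ne_zero 2 (norm_ne_zero_iff.2 h3)) (by linarith)
    exact (pow_eq_one_iff_of_nonneg (norm_nonneg _) two_ne_zero).1 h5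
  refine ⟨huni, fun f hf => ?_, x, hxM, hx0'⟩
  obtain ⟨m, hm, hfm, -⟩ := exists_mem_ker_orthogonal (toeplitz φ) ⟨f, hf⟩
  refine ⟨m, (hmem hm).2, ?_⟩
  rw [← Submodule.starProjection_apply_eq_zero_iff]
  exact congrArg Subtype.val hfm

end Polydisc
end

noncomputable section

namespace Polydisc

/-! ### Fatou's theorem in the disc -/

-- Cauchy's formula for the derivative, minus the analogous integral with pole at the reflected
-- point w₀/r. That integral is zero because the pole lies outside the closed disc; subtracting it
-- gains the factor 1 - r² of the Poisson kernel.
open Metric Complex in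
lemma deriv_eq_circleAverage {G : ℂ → ℂ} (hG : DiffContOnCl ℂ G (ball 0 1)) {w₀ : ℂ}
    (hw₀ : ‖w₀‖ = 1) {r : ℝ} (hr0 : 0 < r) (hr1 : r < 1) :
    deriv G (r * w₀) = Real.circleAverage
      (fun w => w * (((w - r * w₀)⁻¹ ^ 2 - (w - (r : ℂ)⁻¹ * w₀)⁻¹ ^ 2) * G w)) 0 1 := by
  set z : ℂ := r * w₀
  set z' : ℂ := (r : ℂ)⁻¹ * w₀
  have hz : z ∈ ball (0 : ℂ) 1 := by
    simp [z, hw₀, abs_of_pos hr0, hr1]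
  have hz' : 1 < ‖z'‖ := by
    simp only [z', norm_mul, norm_inv, norm_real, hw₀, mul_one, Real.norm_of_nonneg hr0.le]
    exact (one_lt_inv₀ hr0).2 hr1
  have hne : ∀ w ∈ sphere (0 : ℂ) 1, w - z ≠ 0 := fun w hw h => by
    rw [sub_eq_zero] at h
    rw [mem_sphere_zero_iff_norm, h] at hw
    rw [mem_ball_zero_iff, hw] at hz
    exact lt_irrefl _ hz
  have hne' : ∀ w ∈ closedBall (0 : ℂ) 1, w - z' ≠ 0 := fun w hw h => by
    rw [sub_eq_zero] at h
    rw [mem_closedBall_zero_iff, h] at hw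
    exact absurd hw (not_le.2 hz')
  have hcont : ContinuousOn G (sphere 0 1) := hG.continuousOn_ball.mono sphere_subset_closedBall
  have hnhds : ball (0 : ℂ) 1 ∈ 𝓝 z := isOpen_ball.mem_nhds hz
  have hGz : DifferentiableAt ℂ G z := hG.differentiableAt isOpen_ball hz
  -- Cauchy's formula for the difference quotient
  have hq : DiffContOnCl ℂ (dslope G z) (ball 0 1) := by
    refine ⟨(differentiableOn_dslope hnhds).2 hG.differentiableOn, ?_⟩
    rw [closure_ball _ one_ne_zero]
    exact (continuousOn_dslope (Filter.mem_of_superset hnhds ball_subset_closedBall)).2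
      ⟨hG.continuousOn_ball, hGz⟩
  have h1 := hq.circleIntegral_sub_inv_smul hz
  rw [dslope_same] at h1
  have hi1 : CircleIntegrable (fun w => (w - z)⁻¹ ^ 2 * G w) 0 1 := by
    refine ContinuousOn.circleIntegrable zero_le_one (ContinuousOn.mul ?_ hcont)
    exact ((continuousOn_id.sub continuousOn_const).inv₀ hne).pow 2
  have hi2 : CircleIntegrable (fun w => (w - z)⁻¹ ^ 2 * G z) 0 1 := by
    refine ContinuousOn.circleIntegrable zero_le_one (ContinuousOn.mul ?_ continuousOn_const)
    exact ((continuousOn_id.sub continuousOn_const).inv₀ hne).pow 2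
  have hi3 : CircleIntegrable (fun w => (w - z')⁻¹ ^ 2 * G w) 0 1 := by
    refine ContinuousOn.circleIntegrable zero_le_one (ContinuousOn.mul ?_ hcont)
    exact ((continuousOn_id.sub continuousOn_const).inv₀ fun w hw =>
      hne' w (sphere_subset_closedBall hw)).pow 2
  have h2 : ∮ w in C(0, 1), (w - z)⁻¹ ^ 2 * G z = 0 := by
    have h := circleIntegral.integral_sub_zpow_of_ne (by decide : (-2 : ℤ) ≠ -1) (0 : ℂ) z 1
    have h' := circleIntegral.integral_smul_const (fun w : ℂ => (w - z) ^ (-2 : ℤ)) (G z) 0 1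
    rw [h, zero_smul] at h'
    refine Eq.trans (circleIntegral.integral_congr zero_le_one fun w _ => ?_) h'
    simp only [smul_eq_mul, zpow_neg, inv_pow]
    rfl
  have h3 : ∮ w in C(0, 1), (w - z')⁻¹ ^ 2 * G w = 0 := by
    have hd : DiffContOnCl ℂ (fun w => (w - z')⁻¹ ^ 2 * G w) (ball 0 1) := by
      refine ⟨DifferentiableOn.mul (DifferentiableOn.pow (DifferentiableOn.inv
        (differentiableOn_id.sub_const _) fun w hw => hne' w (ball_subset_closedBall hw)) 2)
        hG.differentiableOn, ?_⟩
      rw [closure_ball _ one_ne_zero]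
      exact (((continuousOn_id.sub continuousOn_const).inv₀ hne').pow 2).mul hG.continuousOn_ball
    exact circleIntegral_eq_zero_of_differentiable_on_off_countable zero_le_one
      Set.countable_empty hd.continuousOn_ball fun w hw =>
        hd.differentiableAt isOpen_ball hw.1
  have h4 : ∮ w in C(0, 1), ((w - z)⁻¹ ^ 2 - (w - z')⁻¹ ^ 2) * G w =
      (2 * Real.pi * I) * deriv G z := by
    simp only [sub_mul]
    have h6 := circleIntegral.integral_sub hi1 hi2
    rw [h2, sub_zero] at h6
    rw [circleIntegral.integral_sub hi1 hi3, h3, sub_zero, ← h6]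
    rw [smul_eq_mul] at h1
    rw [← h1]
    refine circleIntegral.integral_congr zero_le_one fun w hw => ?_
    have := hne w hw
    simp only [dslope_of_ne _ (sub_ne_zero.1 this), slope_def_field, smul_eq_mul]
    field_simp
  rw [Real.circleAverage_eq_circleIntegral one_ne_zero]
  have h5 : (∮ w in C(0, 1), (w - 0)⁻¹ • (w * (((w - z)⁻¹ ^ 2 - (w - z')⁻¹ ^ 2) * G w))) =
      ∮ w in C(0, 1), ((w - z)⁻¹ ^ 2 - (w - z')⁻¹ ^ 2) * G w := by
    refine circleIntegral.integral_congr zero_le_one fun w hw => ?_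
    have hw0 : w ≠ 0 := by
      rintro rfl
      simp at hw
    simp only [sub_zero, smul_eq_mul]
    rw [inv_mul_cancel_left₀ hw0]
  rw [h5, h4, smul_eq_mul, inv_mul_cancel_left₀]
  simp [Real.pi_ne_zero]

/-- On the circle the distances to the point r w₀ and to its reflection have constant ratio: r‖b‖ =
‖a‖. The rest is the factorization of a⁻² - b⁻² with ‖b - a‖ = (1 - r²)/r. -/
lemma norm_kernel_le {w w₀ : ℂ} (hw : ‖w‖ = 1) (hw₀ : ‖w₀‖ = 1) {r : ℝ} (hr0 : 0 < r)
    (hr1 : r < 1) :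
    ‖(w - r * w₀)⁻¹ ^ 2 - (w - (r : ℂ)⁻¹ * w₀)⁻¹ ^ 2‖ ≤
      2 * (1 - r ^ 2) / ‖w - r * w₀‖ ^ 3 := by
  set a := w - r * w₀
  set b := w - (r : ℂ)⁻¹ * w₀
  have hrC : (r : ℂ) ≠ 0 := by exact_mod_cast hr0.ne'
  have ha : 0 < ‖a‖ := by
    rw [norm_pos_iff, sub_ne_zero]
    intro h
    rw [h] at hw
    simp [hw₀, abs_of_pos hr0] at hw
    linarith
  have hab : r * ‖b‖ = ‖a‖ := by
    have h1 : r * ‖b‖ = ‖(r : ℂ) * w - w₀‖ := by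
      rw [← Real.norm_of_nonneg hr0.le, ← Complex.norm_real, ← norm_mul]
      simp only [b, Complex.norm_real, Real.norm_of_nonneg hr0.le]
      rw [mul_sub, mul_inv_cancel_left₀ hrC]
    have hc : ∀ u : ℂ, ‖u‖ = 1 → u * (starRingEnd ℂ) u = 1 := fun u hu => by
      rw [Complex.mul_conj, Complex.normSq_eq_norm_sq, hu]; simp
    have h2 : a = -(w * w₀ * (starRingEnd ℂ) ((r : ℂ) * w - w₀)) := by
      simp only [a, map_sub, map_mul, Complex.conj_ofReal]
      linear_combination (-(w : ℂ)) * hc w₀ hw₀ + (r * w₀) * hc w hw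
    rw [h1, h2, norm_neg, norm_mul, norm_mul, hw, hw₀, RCLike.norm_conj]
    ring
  have hb : 0 < ‖b‖ := by
    by_contra h
    have : ‖b‖ = 0 := le_antisymm (not_lt.1 h) (norm_nonneg _)
    rw [this, mul_zero] at hab
    exact ha.ne hab
  have ha' : a ≠ 0 := norm_pos_iff.1 ha
  have hb' : b ≠ 0 := norm_pos_iff.1 hb
  have hid : a⁻¹ ^ 2 - b⁻¹ ^ 2 = (b - a) * (a + b) / (a ^ 2 * b ^ 2) := by
    field_simp
    ring
  have hba : ‖b - a‖ = (1 - r ^ 2) / r := by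
    have : b - a = ((r - r⁻¹ : ℝ) : ℂ) * w₀ := by
      simp only [a, b]
      push_cast
      ring
    rw [this, norm_mul, hw₀, Complex.norm_real, mul_one, Real.norm_of_nonpos]
    · field_simp
      ring
    · have := (one_lt_inv₀ hr0).2 hr1
      linarith
  have hbr : ‖b‖ = ‖a‖ / r := by
    rw [← hab]
    field_simp
  rw [hid, norm_div, norm_mul, norm_mul, norm_pow, norm_pow, hba]
  have h3 : ‖a + b‖ ≤ ‖a‖ + ‖a‖ / r := hbr ▸ norm_add_le a b
  have hr2 : 0 < 1 - r ^ 2 := by nlinarith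
  calc (1 - r ^ 2) / r * ‖a + b‖ / (‖a‖ ^ 2 * ‖b‖ ^ 2)
      ≤ (1 - r ^ 2) / r * (‖a‖ + ‖a‖ / r) / (‖a‖ ^ 2 * ‖b‖ ^ 2) := by gcongr
    _ = (1 + r) * (1 - r ^ 2) / ‖a‖ ^ 3 := by
      rw [hbr]
      field_simp
      ring
    _ ≤ 2 * (1 - r ^ 2) / ‖a‖ ^ 3 := by
      gcongr
      linarith

-- As ‖w - w₀‖ ≤ 2‖w - r w₀‖, a bound ‖G w‖ ≤ c‖w - w₀‖ dominates the integrand by 4c times the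
-- Poisson kernel, whose average is 1. Near w₀ take c = ε; elsewhere take c = K and use ‖w - r w₀‖ ≥
-- δ/2.
open Metric in
lemma norm_deriv_le {G : ℂ → ℂ} (hG : DiffContOnCl ℂ G (ball 0 1)) {w₀ : ℂ} (hw₀ : ‖w₀‖ = 1)
    {K ε δ : ℝ} (hε : 0 ≤ ε) (hδ : 0 < δ) (hK : 0 ≤ K)
    (h1 : ∀ w, ‖w‖ = 1 → ‖G w‖ ≤ K * ‖w - w₀‖)
    (h2 : ∀ w, ‖w‖ = 1 → ‖w - w₀‖ < δ → ‖G w‖ ≤ ε * ‖w - w₀‖) {r : ℝ} (hr0 : 0 < r)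
    (hr1 : r < 1) :
    ‖deriv G (r * w₀)‖ ≤ 4 * ε + 16 * K / δ ^ 2 * (1 - r ^ 2) := by
  have hr2 : 0 < 1 - r ^ 2 := by nlinarith
  have hz : (r : ℂ) * w₀ ∈ ball (0 : ℂ) 1 := by simp [hw₀, abs_of_pos hr0, hr1]
  have hpt : ∀ w ∈ sphere (0 : ℂ) |1|,
      ‖w * (((w - r * w₀)⁻¹ ^ 2 - (w - (r : ℂ)⁻¹ * w₀)⁻¹ ^ 2) * G w)‖ ≤
        4 * ε * poissonKernel 0 (r * w₀) w + 16 * K / δ ^ 2 * (1 - r ^ 2) := by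
    intro w hw
    have hw1 : ‖w‖ = 1 := by simpa using hw
    have hP : poissonKernel 0 (r * w₀) w = (1 - r ^ 2) / ‖w - r * w₀‖ ^ 2 := by
      simp [poissonKernel_def, hw1, hw₀, abs_of_pos hr0]
    have hk := norm_kernel_le hw1 hw₀ hr0 hr1
    have hdist : 1 - r ≤ ‖w - r * w₀‖ := by
      have := norm_sub_norm_le w (r * w₀)
      rwa [hw1, norm_mul, hw₀, Complex.norm_real, Real.norm_of_nonneg hr0.le, mul_one] at this
    have ha : 0 < ‖w - r * w₀‖ := by linarith
    have htri : ‖w - w₀‖ ≤ 2 * ‖w - r * w₀‖ := by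
      have h3 : ‖(r : ℂ) * w₀ - w₀‖ = 1 - r := by
        rw [show (r : ℂ) * w₀ - w₀ = ((r - 1 : ℝ) : ℂ) * w₀ by push_cast; ring, norm_mul, hw₀,
          Complex.norm_real, mul_one, Real.norm_of_nonpos (by linarith)]
        ring
      have := norm_sub_le_norm_sub_add_norm_sub w ((r : ℂ) * w₀) w₀
      linarith
    have hgen : ∀ c, 0 ≤ c → ‖G w‖ ≤ c * ‖w - w₀‖ →
        ‖w * (((w - r * w₀)⁻¹ ^ 2 - (w - (r : ℂ)⁻¹ * w₀)⁻¹ ^ 2) * G w)‖ ≤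
          4 * c * ((1 - r ^ 2) / ‖w - r * w₀‖ ^ 2) := by
      intro c hc hGc
      rw [norm_mul, norm_mul, hw1, one_mul]
      calc _ ≤ 2 * (1 - r ^ 2) / ‖w - r * w₀‖ ^ 3 * (c * (2 * ‖w - r * w₀‖)) :=
            mul_le_mul hk (hGc.trans (mul_le_mul_of_nonneg_left htri hc)) (norm_nonneg _)
              (by positivity)
        _ = _ := by
          field_simp
          ring
    rw [hP]
    rcases lt_or_ge ‖w - w₀‖ δ with h | h
    · have h5 := hgen ε hε (h2 w hw1 h)
      have : 0 ≤ 16 * K / δ ^ 2 * (1 - r ^ 2) := by positivity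
      linarith
    · have h5 := hgen K hK (h1 w hw1)
      have h6 : 4 * K * ((1 - r ^ 2) / ‖w - r * w₀‖ ^ 2) ≤ 16 * K / δ ^ 2 * (1 - r ^ 2) := by
        have h7 : δ / 2 ≤ ‖w - r * w₀‖ := by linarith
        calc 4 * K * ((1 - r ^ 2) / ‖w - r * w₀‖ ^ 2)
            ≤ 4 * K * ((1 - r ^ 2) / (δ / 2) ^ 2) := by gcongr
          _ = _ := by
            field_simp
            ring
      have : 0 ≤ 4 * ε * ((1 - r ^ 2) / ‖w - r * w₀‖ ^ 2) := by positivity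
      linarith
  have hne : ∀ w ∈ sphere (0 : ℂ) 1, w - r * w₀ ≠ 0 := fun w hw h => by
    rw [sub_eq_zero] at h
    rw [mem_sphere_zero_iff_norm, h] at hw
    rw [mem_ball_zero_iff, hw] at hz
    exact lt_irrefl _ hz
  have hPc : ContinuousOn (fun w => poissonKernel 0 (r * w₀) w) (sphere (0 : ℂ) 1) := by
    simp only [poissonKernel_def, sub_zero]
    refine ContinuousOn.div (by fun_prop) (by fun_prop) fun w hw => ?_
    exact pow_ne_zero 2 (norm_ne_zero_iff.2 (hne w hw))
  have hPi : CircleIntegrable (fun w => poissonKernel 0 (r * w₀) w) 0 1 :=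
    hPc.circleIntegrable zero_le_one
  have hP1 : Real.circleAverage (fun w => poissonKernel 0 (r * w₀) w) 0 1 = 1 := by
    have := DiffContOnCl.circleAverage_poissonKernel_smul (f := fun _ => (1 : ℂ)) (c := 0)
      diffContOnCl_const hz
    simp only [Real.circleAverage, Pi.smul_apply', Complex.real_smul, mul_one] at this ⊢
    rw [intervalIntegral.integral_ofReal] at this
    exact_mod_cast this
  have hb : CircleIntegrable
      (fun w => 4 * ε * poissonKernel 0 (r * w₀) w + 16 * K / δ ^ 2 * (1 - r ^ 2)) 0 1 :=
    ((continuousOn_const.mul hPc).add continuousOn_const).circleIntegrable zero_le_one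
  rw [deriv_eq_circleAverage hG hw₀ hr0 hr1]
  calc _ ≤ Real.circleAverage
        (fun w => 4 * ε * poissonKernel 0 (r * w₀) w + 16 * K / δ ^ 2 * (1 - r ^ 2)) 0 1 := by
        rw [Real.circleAverage, Real.circleAverage, norm_smul, smul_eq_mul,
          Real.norm_of_nonneg (by positivity)]
        refine mul_le_mul_of_nonneg_left ?_ (by positivity)
        refine intervalIntegral.norm_integral_le_of_norm_le Real.two_pi_pos.le ?_ hb
        exact Eventually.of_forall fun θ _ => hpt _ (circleMap_mem_sphere' 0 1 θ)
    _ = _ := by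
      have h8 := hP1
      simp only [Real.circleAverage] at h8 ⊢
      rw [intervalIntegral.integral_add (hPi.const_mul _) (by simp),
        intervalIntegral.integral_const_mul]
      simp only [intervalIntegral.integral_const, smul_eq_mul, sub_zero] at h8 ⊢
      have hpi : (2 * Real.pi)⁻¹ * (2 * Real.pi) = 1 := inv_mul_cancel₀ Real.two_pi_pos.ne'
      linear_combination (4 * ε) * h8 + (16 * K / δ ^ 2 * (1 - r ^ 2)) * hpi

end Polydisc
end

/-! ### Radial limits of derivatives of Lipschitz functions -/

noncomputable section

namespace Polydisc

open Metric in
lemma tendsto_deriv_radial {G : ℂ → ℂ} (hG : DiffContOnCl ℂ G (ball 0 1)) {w₀ : ℂ}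
    (hw₀ : ‖w₀‖ = 1) {K : ℝ} (h1 : ∀ w, ‖w‖ = 1 → ‖G w‖ ≤ K * ‖w - w₀‖)
    (h2 : ∀ ε > 0, ∃ δ > 0, ∀ w, ‖w‖ = 1 → ‖w - w₀‖ < δ → ‖G w‖ ≤ ε * ‖w - w₀‖) :
    Tendsto (fun r : ℝ => deriv G (r * w₀)) (𝓝[<] 1) (𝓝 0) := by
  rw [Metric.tendsto_nhds]
  intro η hη
  obtain ⟨δ, hδ, h3⟩ := h2 (η / 8) (by positivity)
  have hlim : Tendsto (fun r : ℝ => 4 * (η / 8) + 16 * |K| / δ ^ 2 * (1 - r ^ 2)) (𝓝[<] 1)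
      (𝓝 (η / 2)) := by
    have : Continuous fun r : ℝ => 4 * (η / 8) + 16 * |K| / δ ^ 2 * (1 - r ^ 2) := by fun_prop
    convert! (this.tendsto 1).mono_left nhdsWithin_le_nhds using 2
    ring
  filter_upwards [hlim.eventually_lt_const (half_lt_self hη), self_mem_nhdsWithin,
    mem_nhdsWithin_of_mem_nhds (lt_mem_nhds (zero_lt_one (α := ℝ)))] with r hr hr1 hr0
  rw [dist_zero_right]
  refine lt_of_le_of_lt (norm_deriv_le hG hw₀ (by positivity) hδ (abs_nonneg K) (fun w hw => ?_) h3
    hr0 hr1) hr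
  exact (h1 w hw).trans (mul_le_mul_of_nonneg_right (le_abs_self K) (norm_nonneg _))

open Metric in
/-- If a Lipschitz function, holomorphic in the disc, is differentiable along the circle at a
point, then its derivative has a radial limit at that point. -/
lemma tendsto_deriv_of_differentiableAt {F : ℂ → ℂ} {K : NNReal} (hF : LipschitzWith K F)
    (hd : DifferentiableOn ℂ F (ball 0 1)) {θ₀ : ℝ}
    (hθ : DifferentiableAt ℝ (fun θ : ℝ => F (Complex.exp (θ * Complex.I))) θ₀) :
    ∃ c, Tendsto (fun r : ℝ => deriv F (r * Complex.exp (θ₀ * Complex.I))) (𝓝[<] 1) (𝓝 c) := by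
  obtain ⟨d, hd'⟩ : ∃ d, HasDerivAt (fun θ : ℝ => F (Complex.exp (θ * Complex.I))) d θ₀ :=
    ⟨_, hθ.hasDerivAt⟩
  set w₀ := Complex.exp (θ₀ * Complex.I)
  have hw₀ : ‖w₀‖ = 1 := Complex.norm_exp_ofReal_mul_I θ₀
  have hw₀0 : w₀ ≠ 0 := Complex.exp_ne_zero _
  -- The slope for which the affine part cancels the derivative along the circle, since exp(iθ) has
  -- derivative i w₀ at θ₀.
  set c : ℂ := d / (w₀ * Complex.I)
  let G : ℂ → ℂ := fun w => F w - F w₀ - c * (w - w₀)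
  have hexp : HasDerivAt (fun θ : ℝ => Complex.exp (θ * Complex.I)) (w₀ * Complex.I) θ₀ := by
    have h1 : HasDerivAt (fun θ : ℝ => (θ : ℂ) * Complex.I) Complex.I θ₀ := by
      simpa using (Complex.ofRealCLM.hasDerivAt (x := θ₀)).mul_const Complex.I
    exact h1.cexp
  have hGd : HasDerivAt (fun θ : ℝ => G (Complex.exp (θ * Complex.I))) 0 θ₀ := by
    have := (hd'.sub_const (F w₀)).sub ((hexp.sub_const w₀).const_mul c)
    convert! this using 1
    simp only [c]
    field_simp
    ring
  have hG0 : G w₀ = 0 := by simp [G]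
  have hGcl : DiffContOnCl ℂ G (ball 0 1) := by
    refine ⟨(hd.sub_const _).sub ((differentiableOn_id.sub_const _).const_mul _), ?_⟩
    have := hF.continuous
    exact Continuous.continuousOn (by fun_prop)
  have hlim := tendsto_deriv_radial hGcl hw₀ (K := K + ‖c‖) (fun w _ => ?_) fun ε hε => ?_
  · refine ⟨c, ?_⟩
    have h3 := hlim.add_const c
    rw [zero_add] at h3
    refine h3.congr' ?_
    filter_upwards [self_mem_nhdsWithin,
      mem_nhdsWithin_of_mem_nhds (lt_mem_nhds (zero_lt_one (α := ℝ)))] with r hr1 hr0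
    have hz : (r : ℂ) * w₀ ∈ ball (0 : ℂ) 1 := by
      have : r < 1 := hr1
      have : 0 < r := hr0
      simpa [hw₀, abs_of_pos this]
    have hFz := (hd.differentiableAt (isOpen_ball.mem_nhds hz)).hasDerivAt
    have := ((hFz.sub_const (F w₀)).sub (((hasDerivAt_id _).sub_const w₀).const_mul c)).deriv
    rw [show deriv G (r * w₀) = _ from this]
    ring
  · have h3 : ‖F w - F w₀‖ ≤ K * ‖w - w₀‖ := by
      simpa [dist_eq_norm] using hF.dist_le_mul w w₀
    calc ‖G w‖ ≤ ‖F w - F w₀‖ + ‖c * (w - w₀)‖ := norm_sub_le _ _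
      _ ≤ (K + ‖c‖) * ‖w - w₀‖ := by
        rw [norm_mul, add_mul]
        linarith
  · have h4 := (hasDerivAt_iff_isLittleO.1 hGd).def (c := ε / (Real.pi / 2)) (by positivity)
    obtain ⟨δ, hδ, h5⟩ := Metric.eventually_nhds_iff.1 h4
    refine ⟨δ / (Real.pi / 2), by positivity, fun w hw hwd => ?_⟩
    set α := Complex.arg (w / w₀)
    have hq : ‖w / w₀‖ = 1 := by rw [norm_div, hw, hw₀, div_one]
    have hα : Complex.exp (α * Complex.I) = w / w₀ := by
      have := Complex.norm_mul_exp_arg_mul_I (w / w₀)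
      rwa [hq, Complex.ofReal_one, one_mul] at this
    have hw' : Complex.exp ((θ₀ + α : ℝ) * Complex.I) = w := by
      rw [Complex.ofReal_add, add_mul, Complex.exp_add, hα]
      exact mul_div_cancel₀ _ hw₀0
    have hangle : |α| ≤ Real.pi / 2 * ‖w - w₀‖ := by
      have h6 := Complex.angle_le_mul_norm_sub (x := 1) (y := w / w₀) (by simp) hq
      rw [Complex.angle_one_left (by rw [← norm_ne_zero_iff, hq]; norm_num)] at h6
      have h7 : ‖1 - w / w₀‖ = ‖w - w₀‖ := by
        rw [show 1 - w / w₀ = -((w - w₀) / w₀) by field_simp; ring, norm_neg, norm_div, hw₀,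
          div_one]
      rwa [h7] at h6
    have hpi : 0 < Real.pi / 2 := by positivity
    have h8 := h5 (y := θ₀ + α) (by
      rw [Real.dist_eq, add_sub_cancel_left]
      refine hangle.trans_lt ?_
      rw [mul_comm]
      exact (lt_div_iff₀ hpi).1 hwd)
    simp only [hw', smul_zero, sub_zero] at h8
    rw [show G (Complex.exp ((θ₀ : ℂ) * Complex.I)) = 0 from hG0, sub_zero, add_sub_cancel_left,
      Real.norm_eq_abs] at h8
    calc ‖G w‖ ≤ ε / (Real.pi / 2) * |α| := h8
      _ ≤ ε / (Real.pi / 2) * (Real.pi / 2 * ‖w - w₀‖) := by gcongr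
      _ = ε * ‖w - w₀‖ := by field_simp

open Metric in
/-- **Fatou's theorem**: a bounded holomorphic function in the disc has radial limits almost
everywhere. -/
theorem ae_exists_radial_limit {g : ℂ → ℂ} (hg : DifferentiableOn ℂ g (ball 0 1)) {C : ℝ}
    (hC : ∀ z ∈ ball (0 : ℂ) 1, ‖g z‖ ≤ C) :
    ∀ᵐ θ : ℝ, ∃ c, Tendsto (fun r : ℝ => g (r * Complex.exp (θ * Complex.I))) (𝓝[<] 1) (𝓝 c) := by
  -- A primitive of `g` is Lipschitz because `g` is bounded. Extended to the plane and restricted to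
  -- the circle it is differentiable almost everywhere, and there its derivative `g` has a radial
  -- limit.
  obtain ⟨F₀, hF₀⟩ := hg.isExactOn_ball
  have hlip : LipschitzOnWith C.toNNReal F₀ (ball 0 1) := by
    refine (convex_ball (0 : ℂ) 1).lipschitzOnWith_of_nnnorm_hasDerivWithin_le
      (fun z hz => (hF₀ z hz).hasDerivWithinAt) fun z hz => ?_
    rw [← NNReal.coe_le_coe, coe_nnnorm]
    exact (hC z hz).trans (Real.le_coe_toNNReal C)
  obtain ⟨F, hF, hFeq⟩ := hlip.extend_finite_dimension
  have hder : ∀ z ∈ ball (0 : ℂ) 1, HasDerivAt F (g z) z := fun z hz =>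
    (hF₀ z hz).congr_of_eventuallyEq (by
      filter_upwards [isOpen_ball.mem_nhds hz] with w hw
      exact (hFeq hw).symm)
  have hexp : LipschitzWith 1 (fun θ : ℝ => Complex.exp (θ * Complex.I)) := by
    refine lipschitzWith_of_nnnorm_deriv_le (𝕜 := ℝ) (fun θ => by fun_prop) fun θ => ?_
    have h1 : HasDerivAt (fun θ : ℝ => (θ : ℂ) * Complex.I) Complex.I θ := by
      simpa using (Complex.ofRealCLM.hasDerivAt (x := θ)).mul_const Complex.I
    rw [h1.cexp.deriv, ← NNReal.coe_le_coe, coe_nnnorm, norm_mul, Complex.norm_exp_ofReal_mul_I,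
      Complex.norm_I]
    simp
  filter_upwards [(hF.comp hexp).ae_differentiableAt_real] with θ hθ
  obtain ⟨c, hc⟩ := tendsto_deriv_of_differentiableAt hF
    (fun z hz => (hder z hz).differentiableAt.differentiableWithinAt) hθ
  refine ⟨c, hc.congr' ?_⟩
  filter_upwards [self_mem_nhdsWithin,
    mem_nhdsWithin_of_mem_nhds (lt_mem_nhds (zero_lt_one (α := ℝ)))] with r hr1 hr0
  refine (hder _ ?_).deriv
  have h1 : r < 1 := hr1
  have h0 : 0 < r := hr0
  rw [mem_ball_zero_iff, norm_mul, Complex.norm_exp_ofReal_mul_I, Complex.norm_real,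
    Real.norm_of_nonneg h0.le, mul_one]
  exact h1

end Polydisc
end

noncomputable section

namespace Polydisc

open UnitAddTorus ComplexConjugate

variable {n : ℕ}

/-! ### Radial limits on the polydisc -/

/-- The limit at `1` from the left of a continuous function on `(0, 1)` can be tested on rational
points. -/
lemma tendsto_iff_tendsto_rat {h : ℝ → ℂ} (hh : ContinuousOn h (Set.Ioo 0 1)) {c : ℂ} :
    Tendsto h (𝓝[<] 1) (𝓝 c) ↔
      Tendsto (fun q : ℚ => h q) (comap (fun q : ℚ => (q : ℝ)) (𝓝[<] 1)) (𝓝 c) := by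
  refine ⟨fun H => H.comp tendsto_comap, fun H => ?_⟩
  rw [Metric.tendsto_nhds]
  intro ε hε
  obtain ⟨s, hs, hsub⟩ := mem_comap.1 (H.eventually (Metric.closedBall_mem_nhds c (half_pos hε)))
  obtain ⟨a, ha, has⟩ := (mem_nhdsLT_iff_exists_Ioo_subset' (zero_lt_one (α := ℝ))).1 hs
  have hmem : Set.Ioo (max a 0) 1 ∈ 𝓝[<] (1 : ℝ) :=
    Ioo_mem_nhdsLT (max_lt ha one_pos)
  filter_upwards [hmem] with r hr
  refine lt_of_le_of_lt ?_ (half_lt_self hε)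
  by_contra hlt
  rw [not_le] at hlt
  have hr0 : r ∈ Set.Ioo (0 : ℝ) 1 := ⟨(le_max_right _ _).trans_lt hr.1, hr.2⟩
  have hcont : ContinuousAt h r := hh.continuousAt (Ioo_mem_nhds hr0.1 hr0.2)
  have hev : ∀ᶠ x in 𝓝 r, ε / 2 < dist (h x) c :=
    (hcont.dist continuousAt_const).eventually_const_lt hlt
  have hev' : ∀ᶠ x in 𝓝 r, x ∈ Set.Ioo a 1 :=
    Ioo_mem_nhds ((le_max_left _ _).trans_lt hr.1) hr.2
  obtain ⟨U, hU, hUo, hrU⟩ := eventually_nhds_iff.1 (hev.and hev')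
  obtain ⟨q, hq⟩ := (Rat.denseRange_cast : DenseRange ((↑) : ℚ → ℝ)).exists_mem_open hUo ⟨r, hrU⟩
  exact absurd (hsub (has (hU q hq).2) : dist (h q) c ≤ ε / 2) (not_le.2 (hU q hq).1)

lemma continuousOn_radial {f : (Fin n → ℂ) → ℂ} (hf : ContinuousOn f (polydisc n))
    (t : UnitAddTorus (Fin n)) : ContinuousOn (fun r : ℝ => f (radialPoint r t)) (Set.Ioo 0 1) := by
  refine hf.comp (Continuous.continuousOn ?_) fun r hr =>
    InnerFunction.radialPoint_mem hr.1.le hr.2 t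
  exact continuous_pi fun i => Complex.continuous_ofReal.mul continuous_const

/-- Rational radii suffice, so the limit runs over a countable family of measurable functions. -/
lemma measurableSet_exists_radial_limit {f : (Fin n → ℂ) → ℂ}
    (hf : ContinuousOn f (polydisc n)) :
    MeasurableSet {t : UnitAddTorus (Fin n) |
      ∃ c, Tendsto (fun r : ℝ => f (radialPoint r t)) (𝓝[<] 1) (𝓝 c)} := by
  let F : ℚ → UnitAddTorus (Fin n) → ℂ := fun q t =>
    if (0 : ℝ) < q ∧ (q : ℝ) < 1 then f (radialPoint q t) else 0
  have hF : ∀ q, Measurable (F q) := by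
    intro q
    by_cases hq : (0 : ℝ) < q ∧ (q : ℝ) < 1
    · simp only [F, if_pos hq]
      exact (hf.comp_continuous (InnerFunction.continuous_radialPoint _) fun t =>
        InnerFunction.radialPoint_mem hq.1.le hq.2 t).measurable
    · simp only [F, if_neg hq]
      exact measurable_const
  convert! measurableSet_exists_tendsto (l := comap (fun q : ℚ => (q : ℝ)) (𝓝[<] 1)) hF using 1
  ext t
  refine exists_congr fun c => ?_
  rw [tendsto_iff_tendsto_rat (continuousOn_radial hf t)]
  refine tendsto_congr' ?_
  have hmem : Set.Ioo (0 : ℝ) 1 ∈ 𝓝[<] (1 : ℝ) := Ioo_mem_nhdsLT one_pos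
  filter_upwards [preimage_mem_comap hmem] with q hq
  exact (if_pos (show (0 : ℝ) < q ∧ (q : ℝ) < 1 from hq)).symm

lemma ae_circle_of_ae_real {p : ℂ → Prop} (hp : MeasurableSet {s : UnitAddCircle | p (AddCircle.toCircle s)})
    (h : ∀ᵐ θ : ℝ, p (Complex.exp (θ * Complex.I))) :
    ∀ᵐ s ∂(AddCircle.haarAddCircle : Measure UnitAddCircle), p (AddCircle.toCircle s) := by
  have hvol : (volume : Measure UnitAddCircle) = AddCircle.haarAddCircle := by
    rw [AddCircle.volume_eq_smul_haarAddCircle, ENNReal.ofReal_one, one_smul]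
  have hmp := AddCircle.measurePreserving_mk (1 : ℝ) 0
  rw [← hvol, ← hmp.map_eq, ae_map_iff hmp.measurable.aemeasurable hp]
  refine ae_restrict_of_ae ?_
  have h2 : ∀ᵐ x : ℝ, p (Complex.exp ((2 * Real.pi * x : ℝ) * Complex.I)) := by
    rw [ae_iff] at h ⊢
    have := Real.volume_preimage_mul_left (a := 2 * Real.pi) Real.two_pi_pos.ne'
      {θ : ℝ | ¬ p (Complex.exp (θ * Complex.I))}
    rw [h, mul_zero] at this
    exact this
  filter_upwards [h2] with x hx
  rw [AddCircle.toCircle_apply_mk, Circle.coe_exp]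
  convert! hx using 4
  simp

/-- Slices of a bounded holomorphic function by discs through the origin. -/
lemma differentiableOn_slice {f : (Fin n → ℂ) → ℂ} (hf : DifferentiableOn ℂ f (polydisc n))
    (t : UnitAddTorus (Fin n)) :
    DifferentiableOn ℂ (fun w : ℂ => f fun i => w * (AddCircle.toCircle (t i) : ℂ))
      (Metric.ball 0 1) := by
  refine hf.comp (Differentiable.differentiableOn ?_) fun w hw i => ?_
  · exact differentiable_pi.2 fun i => differentiable_id.mul_const _
  · rw [norm_mul, Circle.norm_coe, mul_one]
    exact mem_ball_zero_iff.1 hw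

/-- A bounded holomorphic function in the polydisc has radial limits almost everywhere. -/
theorem ae_exists_radial_limit_polydisc {f : (Fin n → ℂ) → ℂ}
    (hf : DifferentiableOn ℂ f (polydisc n)) {C : ℝ} (hC : ∀ z ∈ polydisc n, ‖f z‖ ≤ C) :
    ∀ᵐ t ∂torusMeasure n, ∃ c, Tendsto (fun r : ℝ => f (radialPoint r t)) (𝓝[<] 1) (𝓝 c) := by
  set E : Set (UnitAddTorus (Fin n)) :=
    {t | ∃ c, Tendsto (fun r : ℝ => f (radialPoint r t)) (𝓝[<] 1) (𝓝 c)}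
  have hE : MeasurableSet E := measurableSet_exists_radial_limit hf.continuousOn
  let diag : UnitAddCircle → UnitAddTorus (Fin n) := fun s _ => s
  have hdiag : Continuous diag := continuous_pi fun _ => continuous_id
  -- Through every `t`, Fatou's theorem in the disc w ↦ f(wt) covers almost every rotation `s`.
  -- Fubini then gives one `s` good for almost every `t`, and translation invariance removes it.
  have hslice : ∀ t, ∀ᵐ s ∂(AddCircle.haarAddCircle : Measure UnitAddCircle), t + diag s ∈ E := by
    intro t
    have hd := differentiableOn_slice hf t
    have hrad : ∀ (r : ℝ) (s : UnitAddCircle), radialPoint r (t + diag s) =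
        fun i => (r : ℂ) * (AddCircle.toCircle s : ℂ) * (AddCircle.toCircle (t i) : ℂ) := by
      intro r s
      funext i
      simp only [radialPoint, diag, Pi.add_apply, AddCircle.toCircle_add, Circle.coe_mul]
      ring
    have hiff : ∀ s : UnitAddCircle, t + diag s ∈ E ↔ ∃ c, Tendsto (fun r : ℝ =>
        f fun i => (r : ℂ) * (AddCircle.toCircle s : ℂ) * (AddCircle.toCircle (t i) : ℂ))
        (𝓝[<] 1) (𝓝 c) := fun s => by
      simp only [E, Set.mem_ofPred_eq, hrad]
    have hae := ae_circle_of_ae_real (p := fun w => ∃ c, Tendsto (fun r : ℝ =>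
        f fun i => (r : ℂ) * w * (AddCircle.toCircle (t i) : ℂ)) (𝓝[<] 1) (𝓝 c)) ?_
        (ae_exists_radial_limit hd (C := C) fun w hw => hC _ fun i => ?_)
    · filter_upwards [hae] with s hs
      exact (hiff s).2 hs
    · have : Measurable fun s => t + diag s := (continuous_const.add hdiag).measurable
      convert! this hE using 1
      ext s
      exact (hiff s).symm
    · rw [norm_mul, Circle.norm_coe, mul_one]
      exact mem_ball_zero_iff.1 hw
  have hmeas : MeasurableSet {x : UnitAddTorus (Fin n) × UnitAddCircle | x.1 + diag x.2 ∈ E} := by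
    have : Measurable fun x : UnitAddTorus (Fin n) × UnitAddCircle => x.1 + diag x.2 :=
      (continuous_fst.add (hdiag.comp continuous_snd)).measurable
    exact this hE
  have hswap := (Measure.ae_ae_comm (μ := torusMeasure n)
    (ν := (AddCircle.haarAddCircle : Measure UnitAddCircle)) hmeas).1
    (Eventually.of_forall hslice)
  obtain ⟨s, hs⟩ := hswap.exists
  have h := (measurePreserving_add (-diag s)).quasiMeasurePreserving.ae hs
  filter_upwards [h] with t ht
  rwa [neg_add_cancel_right] at ht

/-! ### Fourier coefficients of radial limits -/

lemma norm_mFourier_apply (k : Fin n → ℤ) (t : UnitAddTorus (Fin n)) : ‖mFourier k t‖ = 1 := by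
  simp [mFourier, fourier_apply, Circle.norm_coe]

lemma tendsto_coef_radial {f : (Fin n → ℂ) → ℂ} (hf : ContinuousOn f (polydisc n)) {C : ℝ}
    (hC : ∀ z ∈ polydisc n, ‖f z‖ ≤ C) {b : LInfty n}
    (hb : ∀ᵐ t ∂torusMeasure n, Tendsto (fun r : ℝ => f (radialPoint r t)) (𝓝[<] 1) (𝓝 (b t)))
    (k : Fin n → ℤ) :
    Tendsto (fun r : ℝ => ∫ t, mFourier (-k) t * f (radialPoint r t) ∂torusMeasure n) (𝓝[<] 1)
      (𝓝 (coef (toL2 b) k)) := by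
  have hcoef : coef (toL2 b) k = ∫ t, mFourier (-k) t * b t ∂torusMeasure n := by
    rw [coef_eq_integral]
    refine integral_congr_ae ?_
    filter_upwards [coeFn_toL2 b] with t ht
    rw [ht]
  rw [hcoef]
  have hmem : Set.Ioo (0 : ℝ) 1 ∈ 𝓝[<] (1 : ℝ) := Ioo_mem_nhdsLT one_pos
  refine tendsto_integral_filter_of_dominated_convergence (fun _ => C) ?_ ?_
    (integrable_const C) ?_
  · filter_upwards [hmem] with r hr
    exact ((mFourier (-k)).continuous.mul (hf.comp_continuous
      (InnerFunction.continuous_radialPoint r) fun t =>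
        InnerFunction.radialPoint_mem hr.1.le hr.2 t)).aestronglyMeasurable
  · filter_upwards [hmem] with r hr
    refine Eventually.of_forall fun t => ?_
    rw [norm_mul, norm_mFourier_apply, one_mul]
    exact hC _ (InnerFunction.radialPoint_mem hr.1.le hr.2 t)
  · filter_upwards [hb] with t ht
    exact ht.const_mul _

/-- An integral over the torus vanishes if the integrals over all circles in a coordinate direction
vanish. -/
lemma integral_eq_zero_of_circle {u : UnitAddTorus (Fin n) → ℂ} (hu : Continuous u) (j : Fin n)
    (h : ∀ t, ∫ s, u (t + (Pi.single j s : UnitAddTorus (Fin n))) ∂(AddCircle.haarAddCircle : Measure UnitAddCircle) = 0) :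
    ∫ t, u t ∂torusMeasure n = 0 := by
  have h1 : ∀ s : UnitAddCircle,
      ∫ t, u (t + Pi.single j s) ∂torusMeasure n = ∫ t, u t ∂torusMeasure n := fun s =>
    (measurePreserving_add _).integral_comp (measurableEmbedding_addRight _) u
  have hcont : Continuous fun x : UnitAddTorus (Fin n) × UnitAddCircle =>
      u (x.1 + Pi.single j x.2) :=
    hu.comp (continuous_fst.add ((continuous_single j).comp continuous_snd))
  have hint : Integrable (Function.uncurry fun (t : UnitAddTorus (Fin n)) (s : UnitAddCircle) =>
      u (t + Pi.single j s))
      ((torusMeasure n).prod (AddCircle.haarAddCircle : Measure UnitAddCircle)) :=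
    hcont.integrable_of_hasCompactSupport (HasCompactSupport.of_compactSpace _)
  have h2 := integral_integral_swap hint
  simp only [h, h1, integral_const, probReal_univ, one_smul] at h2
  exact h2.symm

lemma integral_fourier {k : ℤ} :
    ∫ s, fourier k s ∂(AddCircle.haarAddCircle : Measure UnitAddCircle) = if k = 0 then 1 else 0 := by
  split_ifs with hk
  · simp [hk]
  · exact integral_eq_zero_of_add_right_eq_neg (fourier_add_half_inv_index hk one_pos)

lemma integral_circle_eq_circleAverage (F : ℂ → ℂ) (r : ℝ) :
    ∫ s, F (r * (AddCircle.toCircle s : ℂ)) ∂(AddCircle.haarAddCircle : Measure UnitAddCircle) =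
      Real.circleAverage F 0 r := by
  have h1 := AddCircle.intervalIntegral_preimage (1 : ℝ) 0
    (fun s : UnitAddCircle => F (r * (AddCircle.toCircle s : ℂ)))
  rw [AddCircle.integral_haarAddCircle, ← h1, Real.circleAverage, zero_add, inv_one, one_smul]
  have h2 := intervalIntegral.integral_comp_mul_left (a := 0) (b := 1)
    (fun θ => F (circleMap 0 r θ)) Real.two_pi_pos.ne'
  rw [mul_zero, mul_one] at h2
  rw [← h2]
  refine intervalIntegral.integral_congr fun x _ => ?_
  simp only [AddCircle.toCircle_apply_mk, Circle.coe_exp, circleMap, zero_add, div_one]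

lemma mFourier_add_single (k : Fin n → ℤ) (t : UnitAddTorus (Fin n)) (j : Fin n)
    (s : UnitAddCircle) :
    mFourier k (t + Pi.single j s) = mFourier k t * fourier (k j) s := by
  rw [mFourier_add_apply, mFourier_pi_single]

lemma radialPoint_add_single (r : ℝ) (t : UnitAddTorus (Fin n)) (j : Fin n) (s : UnitAddCircle) :
    radialPoint r (t + Pi.single j s) = Function.update (radialPoint r t) j
      (r * (AddCircle.toCircle s : ℂ) * (AddCircle.toCircle (t j) : ℂ)) := by
  funext i
  by_cases hij : i = j
  · subst hij
    simp only [radialPoint, Pi.add_apply, Pi.single_eq_same, Function.update_self,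
      AddCircle.toCircle_add, Circle.coe_mul]
    ring
  · simp [radialPoint, hij]

lemma continuous_mFourier_mul_radial {f : (Fin n → ℂ) → ℂ} (hf : ContinuousOn f (polydisc n))
    (k : Fin n → ℤ) {r : ℝ} (hr : r ∈ Set.Ioo (0 : ℝ) 1) :
    Continuous fun t => mFourier k t * f (radialPoint r t) :=
  (mFourier k).continuous.mul (hf.comp_continuous (InnerFunction.continuous_radialPoint r) fun t =>
    InnerFunction.radialPoint_mem hr.1.le hr.2 t)

/-- In the variable z_j the integrand is, up to a constant factor, w^p times a holomorphic function
with p = -k_j > 0; by the mean value property its circle average is the value at 0. -/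
lemma integral_radial_eq_zero {f : (Fin n → ℂ) → ℂ} (hf : DifferentiableOn ℂ f (polydisc n))
    {k : Fin n → ℤ} {j : Fin n} (hk : k j < 0) {r : ℝ} (hr : r ∈ Set.Ioo (0 : ℝ) 1) :
    ∫ t, mFourier (-k) t * f (radialPoint r t) ∂torusMeasure n = 0 := by
  refine integral_eq_zero_of_circle (continuous_mFourier_mul_radial hf.continuousOn _ hr) j
    fun t => ?_
  obtain ⟨p, hp⟩ := Int.eq_ofNat_of_zero_le (neg_nonneg.2 hk.le)
  have hp0 : p ≠ 0 := by
    rintro rfl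
    simp at hp
    omega
  let h : ℂ → ℂ := fun w =>
    w ^ p * f (Function.update (radialPoint r t) j (w * (AddCircle.toCircle (t j) : ℂ)))
  have hmaps : ∀ w ∈ Metric.closedBall (0 : ℂ) r,
      Function.update (radialPoint r t) j (w * (AddCircle.toCircle (t j) : ℂ)) ∈ polydisc n := by
    intro w hw i
    by_cases hij : i = j
    · subst hij
      rw [Function.update_self, norm_mul, Circle.norm_coe, mul_one]
      exact (mem_closedBall_zero_iff.1 hw).trans_lt hr.2
    · rw [Function.update_of_ne hij]
      exact InnerFunction.radialPoint_mem hr.1.le hr.2 t i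
  have hd : DiffContOnCl ℂ h (Metric.ball 0 |r|) := by
    rw [abs_of_pos hr.1]
    refine DifferentiableOn.diffContOnCl_ball (U := Metric.closedBall 0 r) ?_ le_rfl
    refine (differentiableOn_id.pow p).mul (hf.comp (Differentiable.differentiableOn ?_) hmaps)
    refine differentiable_pi.2 fun i => ?_
    by_cases hij : i = j
    · subst hij
      simp only [Function.update_self]
      fun_prop
    · simp only [Function.update_of_ne hij]
      exact differentiable_const _
  have hav := integral_circle_eq_circleAverage h r
  rw [hd.circleAverage] at hav
  have h0 : h 0 = 0 := by simp [h, hp0]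
  rw [h0] at hav
  have hrp : (r : ℂ) ^ p ≠ 0 := pow_ne_zero _ (by exact_mod_cast hr.1.ne')
  refine (mul_eq_zero.1 (?_ : (r : ℂ) ^ p * _ = 0)).resolve_left hrp
  rw [← integral_const_mul, ← mul_zero (mFourier (-k) t), ← hav, ← integral_const_mul]
  refine integral_congr_ae (Eventually.of_forall fun s => ?_)
  simp only [mFourier_add_single, radialPoint_add_single, h, Pi.neg_apply, hp, mul_pow]
  rw [show fourier (p : ℤ) s = (AddCircle.toCircle s : ℂ) ^ p by
    simp [fourier_apply, AddCircle.toCircle_nsmul]]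
  ring

lemma integral_radial_eq_zero_of_independent {f : (Fin n → ℂ) → ℂ}
    (hf : ContinuousOn f (polydisc n)) {k : Fin n → ℤ} {j : Fin n} (hk : k j ≠ 0)
    (hind : ∀ z ∈ polydisc n, ∀ w ∈ polydisc n, (∀ i ≠ j, z i = w i) → f z = f w)
    {r : ℝ} (hr : r ∈ Set.Ioo (0 : ℝ) 1) :
    ∫ t, mFourier (-k) t * f (radialPoint r t) ∂torusMeasure n = 0 := by
  refine integral_eq_zero_of_circle (continuous_mFourier_mul_radial hf _ hr) j fun t => ?_
  have h1 : ∀ s, f (radialPoint r (t + Pi.single j s)) = f (radialPoint r t) := fun s =>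
    hind _ (InnerFunction.radialPoint_mem hr.1.le hr.2 _) _
      (InnerFunction.radialPoint_mem hr.1.le hr.2 _) fun i hij => by
        rw [radialPoint_add_single, Function.update_of_ne hij]
  simp only [mFourier_add_single, h1]
  rw [integral_mul_const, integral_const_mul, integral_fourier, if_neg (by simpa using hk),
    mul_zero, zero_mul]

namespace InnerFunction

lemma ae_tendsto_boundary (ψ : InnerFunction n) :
    ∀ᵐ t ∂torusMeasure n,
      Tendsto (fun r : ℝ => ψ.toFun (radialPoint r t)) (𝓝[<] 1) (𝓝 (ψ.boundary t)) := by
  filter_upwards [ψ.ae_tendsto_radialLimit, ψ.memLp_radialLimit.coeFn_toLp] with t h1 h2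
  rw [boundary, h2]
  exact h1.1

lemma unimodular_boundary (ψ : InnerFunction n) : Unimodular ψ.boundary := by
  filter_upwards [ψ.ae_tendsto_radialLimit, ψ.memLp_radialLimit.coeFn_toLp] with t h1 h2
  rw [boundary, h2]
  exact h1.2

lemma coef_boundary_eq_zero (ψ : InnerFunction n) {k : Fin n → ℤ}
    (h : ∀ r ∈ Set.Ioo (0 : ℝ) 1,
      ∫ t, mFourier (-k) t * ψ.toFun (radialPoint r t) ∂torusMeasure n = 0) :
    coef (toL2 ψ.boundary) k = 0 := by
  obtain ⟨C, hC⟩ := ψ.bounded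
  refine tendsto_nhds_unique
    (tendsto_coef_radial ψ.holomorphic.continuousOn hC ψ.ae_tendsto_boundary k) ?_
  have hmem : Set.Ioo (0 : ℝ) 1 ∈ 𝓝[<] (1 : ℝ) := Ioo_mem_nhdsLT one_pos
  refine tendsto_const_nhds.congr' ?_
  filter_upwards [hmem] with r hr
  exact (h r hr).symm

lemma toL2_boundary_mem_hardy (ψ : InnerFunction n) : toL2 ψ.boundary ∈ hardy n :=
  mem_hardy.2 fun _ ⟨_, hj⟩ =>
    ψ.coef_boundary_eq_zero fun _ hr => integral_radial_eq_zero ψ.holomorphic hj hr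

lemma toL2_boundary_mem_indep (ψ : InnerFunction n) {A : Set (Fin n)} (hA : ψ.DependsOnlyOn A)
    {j : Fin n} (hj : j ∉ A) : toL2 ψ.boundary ∈ indep j :=
  (mem_indep_iff ψ.toL2_boundary_mem_hardy).2 fun _ hk => ψ.coef_boundary_eq_zero fun _ hr =>
    integral_radial_eq_zero_of_independent ψ.holomorphic.continuousOn hk
      (fun z hz w hw h => hA z hz w hw fun i hi => h i fun hij => hj (hij ▸ hi)) hr

end InnerFunction

end Polydisc
end

noncomputable section

namespace Polydisc

open UnitAddTorus ComplexConjugate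

variable {n : ℕ}

/-! ### The Szegő kernel and holomorphic extension -/

/-- The value at `z` of the monomial with exponent `k`, if `k ∈ ℕⁿ`, and `0` otherwise. -/
def monomialValue (z : Fin n → ℂ) (k : Fin n → ℤ) : ℂ :=
  ∏ i, if 0 ≤ k i then z i ^ (k i).toNat else 0

lemma monomialValue_of_neg (z : Fin n → ℂ) {k : Fin n → ℤ} {i : Fin n} (hi : k i < 0) :
    monomialValue z k = 0 :=
  Finset.prod_eq_zero (Finset.mem_univ i) (if_neg (not_le.2 hi))

lemma monomialValue_add (z : Fin n → ℂ) {k m : Fin n → ℤ} (hk : ∀ i, 0 ≤ k i)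
    (hm : ∀ i, 0 ≤ m i) : monomialValue z (k + m) = monomialValue z k * monomialValue z m := by
  rw [monomialValue, monomialValue, monomialValue, ← Finset.prod_mul_distrib]
  refine Finset.prod_congr rfl fun i _ => ?_
  rw [if_pos (hk i), if_pos (hm i), Pi.add_apply, if_pos (add_nonneg (hk i) (hm i)),
    Int.toNat_add (hk i) (hm i), pow_add]

@[simp] lemma monomialValue_zero_right (z : Fin n → ℂ) : monomialValue z 0 = 1 := by
  simp [monomialValue]

/-- Expand the geometric series; orthogonality keeps only the term p = k. -/
lemma integral_fourier_mul_geometric {z : ℂ} (hz : ‖z‖ < 1) (k : ℤ) :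
    ∫ s, fourier k s * (1 - z * fourier (-1) s)⁻¹
      ∂(AddCircle.haarAddCircle : Measure UnitAddCircle) = if 0 ≤ k then z ^ k.toNat else 0 := by
  let F : ℕ → UnitAddCircle → ℂ := fun p s => z ^ p * fourier (k - p) s
  have hF : ∀ p, Continuous (F p) := fun p => continuous_const.mul (fourier _).continuous
  have hnorm : ∀ p s, ‖F p s‖ = ‖z‖ ^ p := fun p s => by
    simp [F, fourier_apply, Circle.norm_coe]
  have hsum : ∀ s : UnitAddCircle, HasSum (fun p => F p s)
      (fourier k s * (1 - z * fourier (-1) s)⁻¹) := fun s => by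
    have h1 : ‖z * fourier (-1) s‖ < 1 := by
      simpa [fourier_apply, Circle.norm_coe] using hz
    refine ((hasSum_geometric_of_norm_lt_one h1).mul_left (fourier k s)).congr_fun fun p => ?_
    simp only [F, mul_pow, sub_eq_add_neg, fourier_add]
    have : fourier (-(p : ℤ)) s = (fourier (-1) s : ℂ) ^ p := by
      simp [fourier_apply, AddCircle.toCircle_nsmul, AddCircle.toCircle_neg]
    rw [this]
    ring
  have h := hasSum_integral_of_summable_integral_norm
    (μ := (AddCircle.haarAddCircle : Measure UnitAddCircle)) (F := F)
    (fun p => (hF p).integrable_of_hasCompactSupport (HasCompactSupport.of_compactSpace _)) (by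
      simp only [hnorm, integral_const, probReal_univ, one_smul]
      exact summable_geometric_of_lt_one (norm_nonneg z) hz)
  simp only [fun s => (hsum s).tsum_eq] at h
  refine h.unique ?_
  have hint : ∀ p : ℕ, ∫ s, F p s ∂(AddCircle.haarAddCircle : Measure UnitAddCircle) =
      if k = p then z ^ p else 0 := fun p => by
    simp only [F]
    rw [integral_const_mul, integral_fourier]
    simp [sub_eq_zero]
  simp only [hint]
  split_ifs with hk
  · convert! hasSum_ite_eq k.toNat (z ^ k.toNat) using 2 with p
    have : k = p ↔ p = k.toNat := by omega
    simp only [this]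
    split_ifs with hp
    · rw [hp]
    · rfl
  · convert! hasSum_zero with p
    rw [if_neg]
    omega

/-- The continuous function `t ↦ ∏ (1 - z_i conj t_i)⁻¹` on the torus. -/
def szego (z : Fin n → ℂ) : C(UnitAddTorus (Fin n), ℂ) :=
  ∏ i, Ring.inverse (1 - z i • mFourier (-unit i))

lemma isUnit_szego_factor {z : Fin n → ℂ} (hz : z ∈ polydisc n) (i : Fin n) :
    IsUnit (1 - z i • mFourier (-unit i) : C(UnitAddTorus (Fin n), ℂ)) :=
  isUnit_one_sub_of_norm_lt_one (by rw [norm_smul, mFourier_norm, mul_one]; exact hz i)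

lemma differentiableAt_szego_factor {z : Fin n → ℂ} (hz : z ∈ polydisc n) (i : Fin n) :
    DifferentiableAt ℂ (fun w : Fin n → ℂ =>
      Ring.inverse (1 - w i • mFourier (-unit i) : C(UnitAddTorus (Fin n), ℂ))) z := by
  have h1 : DifferentiableAt ℂ
      (fun w : Fin n → ℂ => (1 - w i • mFourier (-unit i) : C(UnitAddTorus (Fin n), ℂ))) z :=
    (differentiableAt_const _).sub ((differentiableAt_apply (𝕜 := ℂ) i z).smul_const _)
  exact (differentiableAt_inverse (𝕜 := ℂ) (isUnit_szego_factor hz i)).comp z h1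

/-- Inversion is differentiable at units of the Banach algebra of continuous functions, so the
kernel is holomorphic in `z` for the uniform norm. -/
lemma differentiableOn_szego :
    DifferentiableOn ℂ (szego : (Fin n → ℂ) → C(UnitAddTorus (Fin n), ℂ)) (polydisc n) :=
  fun _ hz => (HasFDerivAt.finsetProd (u := Finset.univ) fun i _ =>
    (differentiableAt_szego_factor hz i).hasFDerivAt).differentiableAt.differentiableWithinAt

lemma szego_apply {z : Fin n → ℂ} (hz : z ∈ polydisc n) (t : UnitAddTorus (Fin n)) :
    szego z t = ∏ i, (1 - z i * fourier (-1) (t i))⁻¹ := by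
  rw [szego, ContinuousMap.prod_apply]
  refine Finset.prod_congr rfl fun i _ => ?_
  have h1 := congrArg (fun u : C(UnitAddTorus (Fin n), ℂ) => u t)
    (Ring.mul_inverse_cancel _ (isUnit_szego_factor hz i))
  have h2 : mFourier (-unit i) t = fourier (-1) (t i) := by
    rw [mFourier_neg, mFourier_single, fourier_neg]
  simp only [ContinuousMap.mul_apply, ContinuousMap.sub_apply, ContinuousMap.one_apply,
    ContinuousMap.smul_apply, smul_eq_mul, h2] at h1
  exact (inv_eq_of_mul_eq_one_right h1).symm

lemma integral_mFourier_mul_szego {z : Fin n → ℂ} (hz : z ∈ polydisc n) (k : Fin n → ℤ) :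
    ∫ t, mFourier k t * szego z t ∂torusMeasure n = monomialValue z k := by
  have h : ∀ t, mFourier k t * szego z t =
      ∏ i, (fourier (k i) (t i) * (1 - z i * fourier (-1) (t i))⁻¹) := fun t => by
    rw [szego_apply hz, Finset.prod_mul_distrib]
    rfl
  simp only [h]
  rw [integral_fintype_prod_eq_prod (𝕜 := ℂ)
    (f := fun i s => (fourier (k i) s * (1 - z i * fourier (-1) s)⁻¹ : ℂ))]
  exact Finset.prod_congr rfl fun i _ => integral_fourier_mul_geometric (hz i) (k i)

/-- The Szegő kernel at `z`, as an element of the Hardy space. -/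
def kernel (z : Fin n → ℂ) : L2 n := ContinuousMap.toLp (E := ℂ) 2 (torusMeasure n) ℂ (star (szego z))

lemma coeFn_kernel (z : Fin n → ℂ) :
    kernel z =ᵐ[torusMeasure n] fun t => conj (szego z t) :=
  ContinuousMap.coeFn_toLp (torusMeasure n) (star (szego z))

lemma coef_kernel {z : Fin n → ℂ} (hz : z ∈ polydisc n) (k : Fin n → ℤ) :
    coef (kernel z) k = conj (monomialValue z k) := by
  rw [coef_eq_integral, ← integral_mFourier_mul_szego hz, ← integral_conj]
  refine integral_congr_ae ?_
  filter_upwards [coeFn_kernel z] with t ht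
  rw [ht, map_mul, mFourier_neg]

/-- The holomorphic extension of a function in the Hardy space to the polydisc. -/
def extension (f : L2 n) (z : Fin n → ℂ) : ℂ := inner ℂ (kernel z) f

lemma hasSum_extension (f : L2 n) {z : Fin n → ℂ} (hz : z ∈ polydisc n) :
    HasSum (fun k => monomialValue z k * coef f k) (extension f z) := by
  refine (hasSum_coef (kernel z) f).congr_fun fun k => ?_
  rw [coef_kernel hz, Complex.conj_conj]

/-- The kernel is antiholomorphic in `z` and sits in the conjugate-linear slot; moving the
conjugation to `f` exhibits a continuous linear functional of `szego z`. -/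
lemma differentiableOn_extension (f : L2 n) : DifferentiableOn ℂ (extension f) (polydisc n) := by
  let ℓ : C(UnitAddTorus (Fin n), ℂ) →L[ℂ] ℂ :=
    (innerSL ℂ (star f)).comp (ContinuousMap.toLp (E := ℂ) 2 (torusMeasure n) ℂ)
  have h : ∀ z, extension f z = ℓ (szego z) := fun z => by
    change inner ℂ (kernel z) f = inner ℂ (star f) (ContinuousMap.toLp 2 (torusMeasure n) ℂ (szego z))
    rw [inner_eq_integral, inner_eq_integral]
    refine integral_congr_ae ?_
    filter_upwards [coeFn_kernel z, Lp.coeFn_star f,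
      ContinuousMap.coeFn_toLp (p := 2) (𝕜 := ℂ) (torusMeasure n) (szego z)] with t h1 h2 h3
    rw [h1, h2, h3, Pi.star_apply, RCLike.star_def, Complex.conj_conj, Complex.conj_conj, mul_comm]
  rw [show extension f = fun z => ℓ (szego z) from funext h]
  exact ℓ.differentiable.comp_differentiableOn differentiableOn_szego

/-- The reproducing property of the kernel for products. -/
lemma inner_kernel_laurent {ψ : LInfty n} (hψ : toL2 ψ ∈ hardy n) {z : Fin n → ℂ}
    (hz : z ∈ polydisc n) :
    inner ℂ (kernel z) (laurent ψ (kernel z)) =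
      extension (toL2 ψ) z * inner ℂ (kernel z) (kernel z) := by
  have hmon : ∀ m, coef (kernel z) m * inner ℂ (kernel z) (laurent ψ (monomial m)) =
      extension (toL2 ψ) z * (conj (coef (kernel z) m) * coef (kernel z) m) := by
    intro m
    by_cases hm : ∃ i, m i < 0
    · obtain ⟨i, hi⟩ := hm
      rw [coef_kernel hz, monomialValue_of_neg z hi]
      simp
    push Not at hm
    have h1 : inner ℂ (kernel z) (laurent ψ (monomial m)) =
        extension (toL2 ψ) z * monomialValue z m := by
      rw [laurent_monomial]
      refine (hasSum_coef (kernel z) (shift m (toL2 ψ))).unique ?_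
      have h2 := (hasSum_extension (toL2 ψ) hz).mul_right (monomialValue z m)
      rw [← (Equiv.subRight m).hasSum_iff] at h2
      refine h2.congr_fun fun k => ?_
      simp only [Function.comp_apply, Equiv.subRight_apply]
      rw [coef_kernel hz, Complex.conj_conj, coef_shift]
      by_cases hk : ∃ i, (k - m) i < 0
      · rw [mem_hardy.1 hψ _ hk]
        ring
      · push Not at hk
        have h3 := monomialValue_add z hk hm
        rw [sub_add_cancel] at h3
        rw [h3]
        ring
    rw [h1, coef_kernel hz, Complex.conj_conj]
    ring
  have hrepr : HasSum (fun m => coef (kernel z) m • monomial m) (kernel z) := by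
    refine ((basis n).hasSum_repr (kernel z)).congr_fun fun m => ?_
    rw [(basis n).repr_apply_apply, basis_apply, coef]
  have h1 := hrepr.mapL ((innerSL ℂ (kernel z)).comp (laurent ψ))
  have h2 := (hasSum_coef (kernel z) (kernel z)).mul_left (extension (toL2 ψ) z)
  refine h1.unique (h2.congr_fun fun m => ?_)
  rw [← hmon m]
  simp [innerSL_apply_apply]

/-- The value at `z` is the Rayleigh quotient of multiplication by ψ at the kernel, and
Cauchy–Schwarz bounds it by 1. -/
lemma norm_extension_le {ψ : LInfty n} (hψ : toL2 ψ ∈ hardy n) (h1 : Unimodular ψ)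
    {z : Fin n → ℂ} (hz : z ∈ polydisc n) : ‖extension (toL2 ψ) z‖ ≤ 1 := by
  have hk : kernel z ≠ 0 := fun h => by
    have := coef_kernel hz 0
    rw [h, coef_zero, monomialValue_zero_right, map_one] at this
    exact zero_ne_one this
  have h2 : ‖extension (toL2 ψ) z‖ * (‖kernel z‖ * ‖kernel z‖) ≤ ‖kernel z‖ * ‖kernel z‖ := by
    have hself : ‖inner ℂ (kernel z) (kernel z)‖ = ‖kernel z‖ * ‖kernel z‖ := by
      rw [inner_self_eq_norm_sq_to_K]
      simp [sq]
    have h3 := norm_inner_le_norm (𝕜 := ℂ) (kernel z) (laurent ψ (kernel z))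
    rw [norm_laurent h1, inner_kernel_laurent hψ hz, norm_mul, hself] at h3
    exact h3
  have hpos : 0 < ‖kernel z‖ * ‖kernel z‖ := by
    have := norm_pos_iff.2 hk
    positivity
  exact le_of_mul_le_mul_right (by rwa [one_mul]) hpos

lemma monomialValue_radialPoint (r : ℝ) (t : UnitAddTorus (Fin n)) (k : Fin n → ℤ) :
    monomialValue (radialPoint r t) k = monomialValue (fun _ => (r : ℂ)) k * mFourier k t := by
  by_cases hk : ∃ i, k i < 0
  · obtain ⟨i, hi⟩ := hk
    rw [monomialValue_of_neg _ hi, monomialValue_of_neg _ hi, zero_mul]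
  push Not at hk
  simp only [monomialValue, mFourier, ContinuousMap.coe_mk, ← Finset.prod_mul_distrib]
  refine Finset.prod_congr rfl fun i _ => ?_
  rw [if_pos (hk i), if_pos (hk i), radialPoint, mul_pow]
  congr 1
  obtain ⟨p, hp⟩ := Int.eq_ofNat_of_zero_le (hk i)
  rw [hp]
  simp [fourier_apply, AddCircle.toCircle_nsmul]

lemma integral_extension_radial (f : L2 n) (k : Fin n → ℤ) {r : ℝ} (hr : r ∈ Set.Ioo (0 : ℝ) 1) :
    ∫ t, mFourier (-k) t * extension f (radialPoint r t) ∂torusMeasure n =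
      monomialValue (fun _ => (r : ℂ)) k * coef f k := by
  have hr' : (fun _ : Fin n => (r : ℂ)) ∈ polydisc n := fun i => by
    simpa [abs_of_pos hr.1] using hr.2
  let c : (Fin n → ℤ) → ℂ := fun m => monomialValue (fun _ => (r : ℂ)) m * coef f m
  have hc : Summable fun m => ‖c m‖ := (hasSum_extension f hr').summable.norm
  let F : (Fin n → ℤ) → UnitAddTorus (Fin n) → ℂ := fun m t => c m * mFourier (m - k) t
  have hF : ∀ m, Integrable (F m) (torusMeasure n) := fun m =>
    (continuous_const.mul (mFourier (m - k)).continuous).integrable_of_hasCompactSupport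
      (HasCompactSupport.of_compactSpace _)
  have hnorm : ∀ m t, ‖F m t‖ = ‖c m‖ := fun m t => by
    rw [norm_mul, norm_mFourier_apply, mul_one]
  have hsum : ∀ t, HasSum (fun m => F m t) (mFourier (-k) t * extension f (radialPoint r t)) :=
    fun t => by
      refine ((hasSum_extension f (InnerFunction.radialPoint_mem hr.1.le hr.2 t)).mul_left
        (mFourier (-k) t)).congr_fun fun m => ?_
      simp only [F, c]
      rw [monomialValue_radialPoint, sub_eq_add_neg, mFourier_add]
      ring
  have h := hasSum_integral_of_summable_integral_norm hF (by
    simpa only [hnorm, integral_const, probReal_univ, one_smul] using hc)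
  simp only [fun t => (hsum t).tsum_eq] at h
  refine h.unique ?_
  have hint : ∀ m, ∫ t, F m t ∂torusMeasure n = if m = k then c k else 0 := fun m => by
    have h1 : ∫ t, mFourier (m - k) t ∂torusMeasure n = if m = k then 1 else 0 := by
      have h2 := coef_eq_integral (monomial m) k
      rw [coef_monomial] at h2
      simp only [eq_comm (a := m)]
      rw [h2]
      refine integral_congr_ae ?_
      filter_upwards [coeFn_monomial m] with t ht
      rw [ht, ← mFourier_add, neg_add_eq_sub]
    simp only [F]
    rw [integral_const_mul, h1]
    split_ifs with hm
    · rw [hm, mul_one]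
    · rw [mul_zero]
  simp only [hint]
  exact hasSum_ite_eq k (c k)

lemma tendsto_monomialValue_one {k : Fin n → ℤ} (hk : ∀ i, 0 ≤ k i) :
    Tendsto (fun r : ℝ => monomialValue (fun _ : Fin n => (r : ℂ)) k) (𝓝[<] 1) (𝓝 1) := by
  have hcont : Continuous fun r : ℝ => monomialValue (fun _ : Fin n => (r : ℂ)) k := by
    unfold monomialValue
    refine continuous_finsetProd _ fun i _ => ?_
    simp only [if_pos (hk i)]
    fun_prop
  convert! (hcont.tendsto 1).mono_left nhdsWithin_le_nhds using 2
  simp [monomialValue, hk]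

/-- The radial limits of the holomorphic extension of a unimodular function in the Hardy space. -/
lemma ae_tendsto_extension {ψ : LInfty n} (hψ : toL2 ψ ∈ hardy n) (h1 : Unimodular ψ) :
    ∀ᵐ t ∂torusMeasure n,
      Tendsto (fun r : ℝ => extension (toL2 ψ) (radialPoint r t)) (𝓝[<] 1) (𝓝 (ψ t)) := by
  set f := extension (toL2 ψ)
  have hd : DifferentiableOn ℂ f (polydisc n) := differentiableOn_extension _
  have hbd : ∀ z ∈ polydisc n, ‖f z‖ ≤ 1 := fun z hz => norm_extension_le hψ h1 hz
  let b : UnitAddTorus (Fin n) → ℂ := fun t =>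
    limUnder (𝓝[<] (1 : ℝ)) fun r => f (radialPoint r t)
  have hb : ∀ᵐ t ∂torusMeasure n,
      Tendsto (fun r : ℝ => f (radialPoint r t)) (𝓝[<] 1) (𝓝 (b t)) := by
    filter_upwards [ae_exists_radial_limit_polydisc hd hbd] with t ht
    exact tendsto_nhds_limUnder ht
  have hmem : Set.Ioo (0 : ℝ) 1 ∈ 𝓝[<] (1 : ℝ) := Ioo_mem_nhdsLT one_pos
  obtain ⟨u, -, hu1, hu⟩ := exists_seq_strictMono_tendsto' (zero_lt_one (α := ℝ))
  have hu' : Tendsto u atTop (𝓝[<] 1) :=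
    tendsto_nhdsWithin_iff.2 ⟨hu, Eventually.of_forall fun m => (hu1 m).2⟩
  have hbm : AEStronglyMeasurable b (torusMeasure n) := by
    refine aestronglyMeasurable_of_tendsto_ae atTop (f := fun m t => f (radialPoint (u m) t))
      (fun m => ?_) ?_
    · exact (hd.continuousOn.comp_continuous (InnerFunction.continuous_radialPoint _) fun t =>
        InnerFunction.radialPoint_mem (hu1 m).1.le (hu1 m).2 t).aestronglyMeasurable
    · filter_upwards [hb] with t ht
      exact ht.comp hu'
  have hbLp : MemLp b ∞ (torusMeasure n) := by
    refine memLp_top_of_bound hbm 1 ?_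
    filter_upwards [hb] with t ht
    refine le_of_tendsto ht.norm ?_
    filter_upwards [hmem] with r hr
    exact hbd _ (InnerFunction.radialPoint_mem hr.1.le hr.2 t)
  let B : LInfty n := hbLp.toLp
  have hB : ∀ᵐ t ∂torusMeasure n,
      Tendsto (fun r : ℝ => f (radialPoint r t)) (𝓝[<] 1) (𝓝 (B t)) := by
    filter_upwards [hb, hbLp.coeFn_toLp] with t h2 h3
    rwa [h3]
  -- Fatou's theorem supplies limits but does not identify them. The dilates have coefficients r^|k|
  -- times those of ψ, so the limit function has exactly those of ψ.
  have heq : toL2 B = toL2 ψ := by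
    refine ext_coef fun k => ?_
    refine tendsto_nhds_unique (tendsto_coef_radial hd.continuousOn hbd hB k) ?_
    have h2 : Tendsto (fun r : ℝ => monomialValue (fun _ : Fin n => (r : ℂ)) k * coef (toL2 ψ) k)
        (𝓝[<] 1) (𝓝 (coef (toL2 ψ) k)) := by
      by_cases hk : ∃ i, k i < 0
      · rw [mem_hardy.1 hψ k hk]
        simp
      · push Not at hk
        simpa using (tendsto_monomialValue_one hk).mul_const (coef (toL2 ψ) k)
    refine h2.congr' ?_
    filter_upwards [hmem] with r hr
    exact (integral_extension_radial (toL2 ψ) k hr).symm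
  have h3 := coeFn_toL2 B
  rw [heq] at h3
  filter_upwards [hB, h3, coeFn_toL2 ψ] with t h4 h5 h6
  rwa [← h6, h5]

/-- The inner function with given unimodular boundary values in the Hardy space. -/
def innerExtension (ψ : LInfty n) (hψ : toL2 ψ ∈ hardy n) (h1 : Unimodular ψ) : InnerFunction n where
  toFun := extension (toL2 ψ)
  holomorphic := differentiableOn_extension _
  bounded := ⟨1, fun _ hz => norm_extension_le hψ h1 hz⟩
  unimodular := by
    filter_upwards [ae_tendsto_extension hψ h1, h1] with t h2 h3
    exact ⟨ψ t, h3, h2⟩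

lemma boundary_innerExtension {ψ : LInfty n} (hψ : toL2 ψ ∈ hardy n) (h1 : Unimodular ψ) :
    (innerExtension ψ hψ h1).boundary = ψ := by
  refine Lp.ext ?_
  filter_upwards [(innerExtension ψ hψ h1).ae_tendsto_boundary, ae_tendsto_extension hψ h1]
    with t h2 h3
  exact tendsto_nhds_unique h2 h3

/-- Only frequencies supported in this set contribute to the power series. For ψ and ζ from the
factorization the two sets are disjoint, because each variable is absent from one of them. -/
lemma dependsOnlyOn_innerExtension {ψ : LInfty n} (hψ : toL2 ψ ∈ hardy n) (h1 : Unimodular ψ) :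
    (innerExtension ψ hψ h1).DependsOnlyOn {j | toL2 ψ ∉ indep j} := by
  intro z hz w hw hzw
  refine (hasSum_extension (toL2 ψ) hz).unique
    ((hasSum_extension (toL2 ψ) hw).congr_fun fun k => ?_)
  by_cases hk : ∀ j, toL2 ψ ∈ indep j → k j = 0
  · congr 1
    refine Finset.prod_congr rfl fun i _ => ?_
    by_cases hi : toL2 ψ ∈ indep i
    · simp [hk i hi]
    · rw [hzw i hi]
  · push Not at hk
    obtain ⟨j, hj, hkj⟩ := hk
    rw [(mem_indep_iff hψ).1 hj k hkj, mul_zero, mul_zero]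

end Polydisc
end

/-! ### The characterization of partially isometric Toeplitz operators -/

theorem mainTheorem12 (n : ℕ) (φ : Polydisc.LInfty n) (hφ : φ ≠ 0) :
    Polydisc.IsPartialIsometry (Polydisc.toeplitz φ) ↔
      ∃ ζ ψ : Polydisc.InnerFunction n,
        (∃ A B : Set (Fin n), Disjoint A B ∧ ζ.DependsOnlyOn A ∧ ψ.DependsOnlyOn B) ∧
        Polydisc.toeplitz φ = ContinuousLinearMap.adjoint ψ.M ∘L ζ.M := by
  constructor
  · intro hT
    obtain ⟨huni, hs, hM⟩ := Polydisc.unimodular_of_isPartialIsometry hφ hT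
    obtain ⟨ψ, ζ, hψ1, hζ1, hψ, hζ, hfac, hdisj⟩ := Polydisc.exists_factorization huni hs hM
    refine ⟨Polydisc.innerExtension ζ hζ hζ1, Polydisc.innerExtension ψ hψ hψ1,
      ⟨_, _, ?_, Polydisc.dependsOnlyOn_innerExtension hζ hζ1,
        Polydisc.dependsOnlyOn_innerExtension hψ hψ1⟩, ?_⟩
    · rw [Set.disjoint_left]
      intro j hj hj'
      exact (hdisj j).elim hj' hj
    · rw [Polydisc.InnerFunction.M, Polydisc.InnerFunction.M, Polydisc.boundary_innerExtension,
        Polydisc.boundary_innerExtension]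
      exact Polydisc.toeplitz_eq_adjoint_comp hζ hfac
  · rintro ⟨ζ, ψ, ⟨A, B, hAB, hA, hB⟩, hT⟩
    rw [hT]
    refine Polydisc.isPartialIsometry_of_factorization ψ.toL2_boundary_mem_hardy
      ζ.toL2_boundary_mem_hardy ψ.unimodular_boundary ζ.unimodular_boundary fun j => ?_
    by_cases hj : j ∈ A
    · exact Or.inl (ψ.toL2_boundary_mem_indep hB (Set.disjoint_left.1 hAB hj))
    · exact Or.inr (ζ.toL2_boundary_mem_indep hA hj)
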